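/- **Definitions.** Let $\mathbb F_q$ be a finite field. An $[n,k,d]_q$ code is a $k$-dimensional subspace of $\mathbb F_q^n$ with minimum Hamming distance $d$; $\mathcal C|_S$ denotes the punctured code that keeps only the coordinates in $S$. The code has $(r,\delta)_a$-locality if every coordinate $i$ lies in a set $S_i\subseteq[n]$ with $|S_i|\le r+\delta-1$ such that $\mathcal C|_{S_i}$ has minimum distance at least $\delta$. An *optimal* $[n,k,d]_q$-LRC with $(r,\delta)_a$-locality is an $[n,k,d]_q$ code with $(r,\delta)_a$-locality attaining the Singleton-type bound $$d=n-k+1-\left(\left\lceil\tfrac kr\right\rceil-1\right)(\delta-1).$$ A *$(t,1)_q$ LRCC with parameters $(n_I,k_I,r,\delta;n_F,k_F,r,\delta)_a$* consists of $t$ initial $[n_I,k_I]_q$ codes $\mathcal C_1,\dots,\mathcal C_t$ and a final $[n_F,k_F]_q$ code $\mathcal C_F$, all with $(r,\delta)_a$-locality, where $k_F=tk_I$, together with sets $\mathcal U_i,\mathcal D_i\subseteq[n_I]$ of unchanged and read coordinates for $i\in[t]$, an injection of the disjoint union of the $\mathcal U_i$ into $[n_F]$, and a function $\sigma$ such that $\mathcal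 C_F$ is exactly the set of words obtained from tuples $(\mathbf c_1,\dots,\mathbf c_t)\in\mathcal C_1\times\dots\times\mathcal C_t$ by placing the symbols $\mathbf c_i|_{\mathcal U_i}$ at the prescribed positions and filling the remaining positions with $\sigma(\mathbf c_1|_{\mathcal D_1},\dots,\mathbf c_t|_{\mathcal D_t})$. Its read and write access costs are $\rho_r=\sum_i|\mathcal D_i|$ and $\rho_w=n_F-\sum_i|\mathcal U_i|$. With $k=k_I$, $d_F$ the minimum distance of $\mathcal C_F$, $\phi=\left(\left\lceil\frac{(t-1)k}{r}\right\rceil-1\right)(\delta-1)$ and $\Delta=n_F-2d_F-(t-1)k+2-\phi$, the LRCC is *access-optimal* if $$\rho_w=t\bigl(d_F+(t-1)k-1+\phi\bigr)-(t-1)n_F,$$ $$\rho_r=\begin{cases}tk,&\text{if }\Delta\le0\text{ or }d_F>n_I-k+1,\\ t\left(k-\Delta+(\delta-1)\left\lfloor\frac{\Delta}{r+\delta-1}\right\rfloor\right),&\text{otherwise.}\end{cases}$$ For $(\delta-1)\times(r+\delta-1)$ matrices $A_1,\dots,A_g$ and $(g-\ell)r\times(r+\delta-1)$ matrices $B_1,\dots,B_g$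 over $\mathbb F_q$, let $H$ be the block matrix with $A_1,\dots,A_g$ on the diagonal and the block row $(B_1\ \cdots\ B_g)$ below. For $\mathcal Q\subseteq[g]$, let $H||_{\mathcal Q}$ be the same matrix formed only from the $A_j,B_j$ with $j\in\mathcal Q$. **Theorem.** Let $g,\ell,r,\delta,t$ be positive integers with $t\mid\ell$, $\ell/t>g-\ell\ge0$ and $\delta\ge2$, and let $\mathcal C$ be an optimal $[g(r+\delta-1),\ell r,d]_q$-LRC with $(r,\delta)_a$-locality. Then, after a suitable rearrangement of its coordinates, $\mathcal C$ has a parity check matrix $H$ of the above block form, such that for every integer $0\le h\le g-\ell$ there is an access-optimal $(t,1)_q$ LRCC with parameters $$\bigl((\ell/t+g-\ell)(r+\delta-1),\ \ell r/t,\ r,\ \delta;\ (\ell+h)(r+\delta-1),\ \ell r,\ r,\ \delta\bigr)_a$$ whose initial codes and final code all attain the Singleton-type bound. Moreover, up to rearrangement of coordinates, its $i$-th initial code has parity check matrix $H||_{\mathcal P_i\cup\mathcal P}$, where $\mathcal P_i=\{(i-1)\ell/t+1,\dots,i\ell/t\}$ and $\mathcal P=\{\ell+1,\dots,g\}$, and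 its final code is the punctured code of $\mathcal C$ on the first $\ell+h$ blocks of coordinates. -/

import Mathlib

/-! ### Linear codes

A linear code over `F` with coordinates indexed by a finite type `ι` is a subspace of `ι → F`;
an `[n, k]` code is a `k`-dimensional subspace of `Fin n → F`. -/

/-- The punctured code `C|_S`: all symbols outside `S` are deleted. -/
def puncturedCode {F ι : Type*} [Field F] (C : Submodule F (ι → F)) (S : Finset ι) :
    Submodule F ({i // i ∈ S} → F) :=
  C.map (LinearMap.funLeft F F (fun i : {i // i ∈ S} => (i : ι)))

/-- `d` is the minimum Hamming distance of `C`, i.e. the least weight of a nonzero codeword. -/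
def IsMinDist {F ι : Type*} [Field F] [DecidableEq F] [Fintype ι]
    (C : Submodule F (ι → F)) (d : ℕ) : Prop :=
  IsLeast {w : ℕ | ∃ c ∈ C, c ≠ 0 ∧ hammingNorm c = w} d

/-- The minimum Hamming distance of `C` is at least `δ`. -/
def MinDistAtLeast {F ι : Type*} [Field F] [DecidableEq F] [Fintype ι]
    (C : Submodule F (ι → F)) (δ : ℕ) : Prop :=
  ∀ c ∈ C, c ≠ 0 → δ ≤ hammingNorm c

/-- All symbol `(r, δ)`-locality: every coordinate `i` lies in an `(r, δ)`-repair set `S`. -/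
def HasAllSymbolLocality {F ι : Type*} [Field F] [DecidableEq F]
    (C : Submodule F (ι → F)) (r δ : ℕ) : Prop :=
  ∀ i : ι, ∃ S : Finset ι, i ∈ S ∧ S.card ≤ r + δ - 1 ∧ MinDistAtLeast (puncturedCode C S) δ

/-- `(⌈k / r⌉ - 1) (δ - 1)`, as an integer (equal to `-(δ - 1)` for `k = 0`). -/
def localityDefect (k r δ : ℕ) : ℤ := (⌈(k : ℚ) / (r : ℚ)⌉ - 1) * ((δ : ℤ) - 1)

/-- The Singleton-type bound `n - k + 1 - (⌈k / r⌉ - 1) (δ - 1)` on the minimum distance of an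
`[n, k]` code with all symbol `(r, δ)`-locality. -/
def singletonTypeBound (n k r δ : ℕ) : ℤ := (n : ℤ) - k + 1 - localityDefect k r δ

/-- `C` is an optimal `[n, k, d]` LRC with all symbol `(r, δ)`-locality: its minimum distance `d`
attains the Singleton-type bound. -/
structure IsOptimalLRC {F : Type*} [Field F] [DecidableEq F] {n : ℕ}
    (C : Submodule F (Fin n → F)) (k d r δ : ℕ) : Prop where
  dim_eq : Module.finrank F C = k
  locality : HasAllSymbolLocality C r δ
  minDist : IsMinDist C d
  attains : (d : ℤ) = singletonTypeBound n k r δ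

/-! ### Parity check matrices in block form -/

/-- The code with parity check matrix `H`. -/
def codeOfParityCheck {F ρ κ : Type*} [Field F] [Fintype κ] (H : Matrix ρ κ F) :
    Submodule F (κ → F) :=
  LinearMap.ker H.mulVecLin

/-- The matrix with the blocks `A p` on the diagonal and the blocks `B p` side by side below them.
The column indexed by `(x, p)` is the `x`-th column of the `p`-th block column. -/
def blockParityCheck {F P : Type*} [Field F] [DecidableEq P] {a b m : ℕ}
    (A : P → Matrix (Fin a) (Fin m) F) (B : P → Matrix (Fin b) (Fin m) F) :
    Matrix ((Fin a × P) ⊕ Fin b) (Fin m × P) F :=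
  Matrix.fromRows (Matrix.blockDiagonal A) (Matrix.of fun y xp => B xp.2 y xp.1)

/-- The submatrix `H||_P` of the block matrix `H` given by `A` and `B`: only the blocks with index
in `P` are kept. -/
def subBlockParityCheck {F : Type*} [Field F] {g a b m : ℕ}
    (A : Fin g → Matrix (Fin a) (Fin m) F) (B : Fin g → Matrix (Fin b) (Fin m) F)
    (P : Finset (Fin g)) :
    Matrix ((Fin a × {p // p ∈ P}) ⊕ Fin b) (Fin m × {p // p ∈ P}) F :=
  blockParityCheck (fun p => A p.1) (fun p => B p.1)

/-- `C` becomes `C'` when its coordinates are relabelled along `e`. -/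
def IsRearrangement {F ι κ : Type*} [Field F] (e : ι ≃ κ)
    (C : Submodule F (ι → F)) (C' : Submodule F (κ → F)) : Prop :=
  C.map (LinearMap.funLeft F F e.symm) = C'

/-- The block indices used by the `i`-th initial code: the `i`-th of the `t` consecutive groups of
`ℓ / t` blocks among the first `ℓ` blocks, together with the last `g - ℓ` blocks
(everything counted from `0`). -/
def initialBlocks (g ℓ t : ℕ) (i : Fin t) : Finset (Fin g) :=
  Finset.univ.filter fun p =>
    ((i : ℕ) * (ℓ / t) ≤ (p : ℕ) ∧ (p : ℕ) < ((i : ℕ) + 1) * (ℓ / t)) ∨ ℓ ≤ (p : ℕ)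

/-- The coordinates that a rearrangement `e` into blocks puts into one of the first `u` blocks. -/
def leadingCoords {n m g : ℕ} (e : Fin n ≃ Fin m × Fin g) (u : ℕ) : Finset (Fin n) :=
  Finset.univ.filter fun x => ((e x).2 : ℕ) < u

/-! ### Convertible codes in the merge regime -/

/-- A `(t, 1)` convertible code over `F`: `t` initial codes of length `nI`, one final code of
length `nF`, and a conversion procedure. From the codeword of the `i`-th initial code the symbols
in `unchanged i` are kept, and they become the symbols of the final codeword at the positions
`place ⟨i, _⟩`; all other symbols of the final codeword are written, and they are computed by
`conv` from the symbols in the sets `read i` alone. -/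
structure MergeConvertibleCode (F : Type*) [Field F] (t nI nF : ℕ) where
  initial : Fin t → Submodule F (Fin nI → F)
  final : Submodule F (Fin nF → F)
  dim_eq : ∑ i, Module.finrank F (initial i) = Module.finrank F final
  unchanged : Fin t → Finset (Fin nI)
  read : Fin t → Finset (Fin nI)
  place : (Σ i : Fin t, {a // a ∈ unchanged i}) ↪ Fin nF
  conv : (∀ i : Fin t, {a // a ∈ read i} → F) → {b // b ∉ Set.range place} → F
  final_eq : (final : Set (Fin nF → F)) =
    {c | ∃ x : Fin t → Fin nI → F, (∀ i, x i ∈ initial i) ∧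
      (∀ i (a : {a // a ∈ unchanged i}), c (place ⟨i, a⟩) = x i a.1) ∧
      (∀ b : {b // b ∉ Set.range place}, c b.1 = conv (fun i a => x i a.1) b)}

namespace MergeConvertibleCode

/-- The read access cost: the number of symbols of the initial codes that are read. -/
def readCost {F : Type*} [Field F] {t nI nF : ℕ} (X : MergeConvertibleCode F t nI nF) : ℕ :=
  ∑ i, (X.read i).card

/-- The write access cost: the number of written symbols of the final code. -/
def writeCost {F : Type*} [Field F] {t nI nF : ℕ} (X : MergeConvertibleCode F t nI nF) : ℤ :=
  (nF : ℤ) - ∑ i, ((X.unchanged i).card : ℤ)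

/-- `X` is an LRCC with parameters `(nI, kI, rI, δI; nF, kF, rF, δF)_a`. -/
structure IsLRCC {F : Type*} [Field F] [DecidableEq F] {t nI nF : ℕ}
    (X : MergeConvertibleCode F t nI nF) (kI rI δI kF rF δF : ℕ) : Prop where
  dim_initial : ∀ i, Module.finrank F (X.initial i) = kI
  locality_initial : ∀ i, HasAllSymbolLocality (X.initial i) rI δI
  dim_final : Module.finrank F X.final = kF
  locality_final : HasAllSymbolLocality X.final rF δF

end MergeConvertibleCode

/-- The lower bound on the write access cost of a `(t, 1)` LRCC with parameters
`(nI, k, *, *; nF, t k, r, δ)_a` whose final code has minimum distance `d`. -/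
def writeCostBound (t k nF r δ d : ℕ) : ℤ :=
  (t : ℤ) * ((d : ℤ) + ((t : ℤ) - 1) * k - 1 + localityDefect ((t - 1) * k) r δ)
    - ((t : ℤ) - 1) * nF

/-- The quantity `Δ` in the lower bound on the read access cost. -/
def readCostDelta (t k nF r δ d : ℕ) : ℤ :=
  (nF : ℤ) - 2 * d - ((t : ℤ) - 1) * k + 2 - localityDefect ((t - 1) * k) r δ

/-- The lower bound on the read access cost of a `(t, 1)` LRCC with parameters
`(nI, k, *, *; nF, t k, r, δ)_a` whose final code has minimum distance `d`. -/
def readCostBound (t k nI nF r δ d : ℕ) : ℤ :=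
  if readCostDelta t k nF r δ d ≤ 0 ∨ (nI : ℤ) - k + 1 < d then (t : ℤ) * k
  else (t : ℤ) * ((k : ℤ) - readCostDelta t k nF r δ d
    + ((δ : ℤ) - 1) * ⌊(readCostDelta t k nF r δ d : ℚ) / ((r : ℚ) + δ - 1)⌋)

/-- Access-optimality of a `(t, 1)` LRCC with initial dimension `k`, whose final code has all
symbol `(r, δ)`-locality: both access costs equal their lower bounds, with `d` the minimum
distance of the final code. -/
def MergeConvertibleCode.IsAccessOptimal {F : Type*} [Field F] [DecidableEq F] {t nI nF : ℕ}
    (X : MergeConvertibleCode F t nI nF) (k r δ : ℕ) : Prop :=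
  ∃ d : ℕ, IsMinDist X.final d ∧
    (X.readCost : ℤ) = readCostBound t k nI nF r δ d ∧
    X.writeCost = writeCostBound t k nF r δ d

/-! Write `δ = s + 1` and `ℓ = t * w`. For a set `S` of coordinates let `f(S)` be the dimension of
the subcode vanishing on `S`; then `|S| + f(S) - ℓ r` is the redundancy of `S`, its size minus its
rank. The minimum distance forces redundancy at most `(ℓ - 1) s` whenever `f(S) > 0`, while
adjoining a repair set that meets the support of a surviving codeword adds at least `s` redundancy
and costs at most `r` dimensions. Attaining the Singleton-type bound leaves no slack, so each repair
set has exactly `r + s` coordinates and rank `r`, and two repair sets are equal or disjoint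
(`repairSet_eq_or_disjoint`). They partition the coordinates into `g` blocks, and any `j ≤ ℓ` blocks
have rank `j r` (`finrank_vanishingSubcode_blocks`).

The local codes on the blocks give the `A p`. The product of these local codes has dimension `g r`,
so `(g - ℓ) r` further equations cut out the code; they give the `B p`. Keeping only some blocks of
`H` means shortening. Shortening (`IsBlockLRC.shorten`) and puncturing to at least `ℓ` blocks
(`IsBlockLRC.map_blocks`) preserve the block structure, and `exists_weight_le` shows that all
resulting codes are optimal.

The initial codes are the shortenings to `P_i ∪ P`. Two of these supports meet only in the `g - ℓ`
blocks of `P`, too few to carry a nonzero codeword, so the sum of the initial codes is direct; by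
dimension it is the whole code (`exists_sum_extendBlocks_eq`). Conversion adds the initial
codewords: on `P_i` only one summand is nonzero, so its symbols stay, and each of the `h` new blocks
is the sum of the initial blocks there, each determined by any `r` of its symbols. This reads `t h
r` symbols and writes `h (r + s)`, which equal the two bounds. -/

/-- The subcode of `C` consisting of the codewords that vanish on `S`. -/
def vanishingSubcode {F ι : Type*} [Field F] (C : Submodule F (ι → F)) (S : Finset ι) :
    Submodule F (ι → F) :=
  C ⊓ LinearMap.ker (LinearMap.funLeft F F (fun i : {i // i ∈ S} => (i : ι)))

/-- `R` is a repair set of size at most `m` and distance at least `δ`, in terms of the codewords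
of `C` themselves. -/
def IsRepairSet {F ι : Type*} [Field F] [DecidableEq F] (C : Submodule F (ι → F)) (m δ : ℕ)
    (R : Finset ι) : Prop :=
  R.card ≤ m ∧ ∀ c ∈ C, (∃ i ∈ R, c i ≠ 0) → δ ≤ (R.filter fun i => c i ≠ 0).card

/-! ### Dimension and redundancy of subcodes vanishing on a set. -/

section VanishingSubcode

variable {F ι : Type*} [Field F] {C : Submodule F (ι → F)}

theorem mem_vanishingSubcode {S : Finset ι} {c : ι → F} :
    c ∈ vanishingSubcode C S ↔ c ∈ C ∧ ∀ i ∈ S, c i = 0 := by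
  simp [vanishingSubcode, funext_iff, LinearMap.funLeft]

theorem vanishingSubcode_empty : vanishingSubcode C ∅ = C := by
  ext c; simp [mem_vanishingSubcode]

theorem vanishingSubcode_anti {S T : Finset ι} (h : S ⊆ T) :
    vanishingSubcode C T ≤ vanishingSubcode C S := fun c hc => by
  rw [mem_vanishingSubcode] at hc ⊢
  exact ⟨hc.1, fun i hi => hc.2 i (h hi)⟩

variable [Fintype ι]

theorem exists_ne_zero_of_finrank_vanishingSubcode_pos {S : Finset ι}
    (h : 0 < Module.finrank F (vanishingSubcode C S)) :
    ∃ c ∈ vanishingSubcode C S, ∃ i, c i ≠ 0 := by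
  have := Module.finrank_pos_iff.mp h
  obtain ⟨x, hx⟩ := exists_ne (0 : vanishingSubcode C S)
  refine ⟨x, x.2, ?_⟩
  by_contra! hcon
  exact hx (Subtype.ext (funext hcon))

theorem finrank_vanishingSubcode_lt {S T : Finset ι} (h : S ⊆ T) {c : ι → F}
    (hc : c ∈ vanishingSubcode C S) {i : ι} (hi : i ∈ T) (hci : c i ≠ 0) :
    Module.finrank F (vanishingSubcode C T) < Module.finrank F (vanishingSubcode C S) := by
  apply Submodule.finrank_lt_finrank_of_lt
  refine lt_of_le_of_ne (vanishingSubcode_anti h) fun heq => hci ?_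
  rw [← heq, mem_vanishingSubcode] at hc
  exact hc.2 i hi

variable [DecidableEq ι]

theorem finrank_vanishingSubcode_le (S T : Finset ι) :
    Module.finrank F (vanishingSubcode C S) ≤
      Module.finrank F (vanishingSubcode C (S ∪ T)) + T.card := by
  set K := LinearMap.ker (LinearMap.funLeft F F (fun i : {i // i ∈ T} => (i : ι)))
  have h1 : vanishingSubcode C (S ∪ T) = vanishingSubcode C S ⊓ K := by
    ext c
    simp only [mem_vanishingSubcode, Submodule.mem_inf, Finset.mem_union, K, LinearMap.mem_ker,
      funext_iff, LinearMap.funLeft_apply, Pi.zero_apply, Subtype.forall]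
    grind
  have h2 := Submodule.finrank_sup_add_finrank_inf_eq (vanishingSubcode C S) K
  have h3 := LinearMap.finrank_range_add_finrank_ker
    (LinearMap.funLeft F F (fun i : {i // i ∈ T} => (i : ι)))
  have h4 := Submodule.finrank_le (vanishingSubcode C S ⊔ K)
  have h5 := Submodule.finrank_le
    (LinearMap.range (LinearMap.funLeft F F (fun i : {i // i ∈ T} => (i : ι))))
  rw [Module.finrank_fintype_fun_eq_card, Fintype.card_coe] at h5
  rw [h1]
  change _ + Module.finrank F K = _ at h3
  omega

variable [DecidableEq F]

/-- Adjoining a repair set either loses no dimension or adds at least `s` to the redundancy `|U| +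
f(U) - dim C`, because its last `s` new coordinates are determined by the others. -/
theorem IsRepairSet.finrank_vanishingSubcode_union {m s : ℕ} {R : Finset ι}
    (hR : IsRepairSet C m (s + 1) R) (U : Finset ι) :
    Module.finrank F (vanishingSubcode C (U ∪ R)) = Module.finrank F (vanishingSubcode C U) ∨
      Module.finrank F (vanishingSubcode C U) + s ≤
        Module.finrank F (vanishingSubcode C (U ∪ R)) + (R \ U).card := by
  -- All but `s` of the new coordinates. A codeword vanishing on `U ∪ T` has at most `s` nonzero
  -- entries in `R`, hence none. If `R` has fewer than `s` new coordinates, `T` is empty and the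
  -- dimension does not change.
  obtain ⟨T, hT, hTc⟩ := Finset.exists_subset_card_eq (Nat.sub_le (R \ U).card s)
  have key : vanishingSubcode C (U ∪ T) ≤ vanishingSubcode C (U ∪ R) := fun c hc => by
    rw [mem_vanishingSubcode] at hc ⊢
    refine ⟨hc.1, fun i hi => ?_⟩
    by_contra hne
    have hiR : i ∈ R := by
      rcases Finset.mem_union.mp hi with h | h
      · exact absurd (hc.2 i (Finset.mem_union_left _ h)) hne
      · exact h
    have h1 := hR.2 c hc.1 ⟨i, hiR, hne⟩
    have h2 : (R.filter fun i => c i ≠ 0) ⊆ (R \ U) \ T := fun j hj => by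
      rw [Finset.mem_filter] at hj
      simp only [Finset.mem_sdiff]
      exact ⟨⟨hj.1, fun h => hj.2 (hc.2 j (Finset.mem_union_left _ h))⟩,
        fun h => hj.2 (hc.2 j (Finset.mem_union_right _ h))⟩
    have h3 := Finset.card_le_card h2
    rw [Finset.card_sdiff_of_subset hT] at h3
    omega
  have h1 := Submodule.finrank_mono key
  have h2 := finrank_vanishingSubcode_le (C := C) U T
  have h3 := Submodule.finrank_mono (vanishingSubcode_anti (C := C)
    (Finset.subset_union_left (s₁ := U) (s₂ := R)))
  omega

theorem IsRepairSet.finrank_vanishingSubcode_le {r s : ℕ} {R : Finset ι}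
    (hR : IsRepairSet C (r + s) (s + 1) R) (U : Finset ι) :
    Module.finrank F (vanishingSubcode C U) ≤
      Module.finrank F (vanishingSubcode C (U ∪ R)) + r := by
  have h1 := hR.finrank_vanishingSubcode_union U
  have h2 := hR.1
  have h3 := Finset.card_le_card (Finset.sdiff_subset (s := R) (t := U))
  omega

/-- If every nonzero codeword has weight at least `|ι| - M + 1`, then nonzero shortened codes
obey the Singleton bound. -/
theorem card_add_finrank_vanishingSubcode_le {M : ℕ}
    (hd : ∀ c ∈ C, c ≠ 0 → Fintype.card ι + 1 ≤ hammingNorm c + M) {S : Finset ι}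
    (hS : 0 < Module.finrank F (vanishingSubcode C S)) :
    S.card + Module.finrank F (vanishingSubcode C S) ≤ M := by
  suffices H : ∀ w, ∀ S : Finset ι, w + 1 ≤ Module.finrank F (vanishingSubcode C S) →
      S.card + (w + 1) ≤ M by
    have := H (Module.finrank F (vanishingSubcode C S) - 1) S (by omega)
    omega
  intro w
  induction w with
  | zero =>
    intro S hS
    obtain ⟨c, hc, i, hi⟩ := exists_ne_zero_of_finrank_vanishingSubcode_pos hS
    rw [mem_vanishingSubcode] at hc
    have h1 := hd c hc.1 (fun h => hi (by simp [h]))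
    have h2 : hammingNorm c ≤ Sᶜ.card := Finset.card_le_card fun j hj => by
      rw [Finset.mem_compl]
      intro hjS
      simp [hc.2 j hjS] at hj
    have h3 := S.card_add_card_compl
    omega
  -- Forcing one more nonzero coordinate to vanish enlarges `S` by one and costs at most one
  -- dimension; in dimension one the claim is the weight bound itself.
  | succ w ih =>
    intro S hS
    obtain ⟨c, hc, i, hi⟩ := exists_ne_zero_of_finrank_vanishingSubcode_pos
      (show 0 < Module.finrank F (vanishingSubcode C S) by omega)
    have hiS : i ∉ S := fun h => hi ((mem_vanishingSubcode.mp hc).2 i h)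
    have h1 := _root_.finrank_vanishingSubcode_le (C := C) S {i}
    rw [Finset.card_singleton] at h1
    have h2 := ih (S ∪ {i}) (by omega)
    rw [Finset.card_union_of_disjoint (by simpa using hiS), Finset.card_singleton] at h2
    omega

end VanishingSubcode

/-! ### Rigidity: repair sets of an optimal code partition the coordinates. -/

/-- `C` has dimension `ℓ r`, all symbol locality with repair sets of size at most `r + s` and
distance at least `s + 1`, and minimum distance at least `n - ℓ (r + s) + s + 1`; these are the
parameters of an optimal code. -/
structure IsTightLRC {F ι : Type*} [Field F] [DecidableEq F] [Fintype ι]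
    (C : Submodule F (ι → F)) (ℓ r s : ℕ) : Prop where
  dim_eq : Module.finrank F C = ℓ * r
  weight : ∀ c ∈ C, c ≠ 0 → Fintype.card ι + (s + 1) ≤ hammingNorm c + ℓ * (r + s)
  repair : ∀ i, ∃ R, i ∈ R ∧ IsRepairSet C (r + s) (s + 1) R

namespace IsTightLRC

variable {F ι : Type*} [Field F] [DecidableEq F] [Fintype ι] [DecidableEq ι]
  {C : Submodule F (ι → F)} {ℓ r s : ℕ}

theorem exists_repairSet_step (hC : IsTightLRC C ℓ r s)
    {U : Finset ι} (hU : 0 < Module.finrank F (vanishingSubcode C U)) :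
    ∃ R : Finset ι, R.card ≤ r + s ∧ Module.finrank F (vanishingSubcode C U) + s ≤
        Module.finrank F (vanishingSubcode C (U ∪ R)) + (R \ U).card := by
  obtain ⟨c, hc, i, hi⟩ := exists_ne_zero_of_finrank_vanishingSubcode_pos hU
  obtain ⟨R, hiR, hR⟩ := hC.repair i
  refine ⟨R, hR.1, (hR.finrank_vanishingSubcode_union U).resolve_left fun h => ?_⟩
  have := finrank_vanishingSubcode_lt (Finset.subset_union_left (s₂ := R)) hc
    (Finset.mem_union_right U hiR) hi
  omega

/-- In terms of redundancy: while a nonzero codeword survives, the redundancy of `S` is at most `(ℓ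
- 1) s`. -/
theorem card_add_finrank_add_le (hC : IsTightLRC C ℓ r s) {S : Finset ι}
    (hS : 0 < Module.finrank F (vanishingSubcode C S)) :
    S.card + Module.finrank F (vanishingSubcode C S) + s ≤ ℓ * (r + s) := by
  obtain ⟨c, hc, i, hi⟩ := exists_ne_zero_of_finrank_vanishingSubcode_pos hS
  have h0 := hC.weight c (mem_vanishingSubcode.mp hc).1 (fun h => hi (by simp [h]))
  have h1 : hammingNorm c ≤ Fintype.card ι := hammingNorm_le_card_fintype
  have := card_add_finrank_vanishingSubcode_le (C := C) (M := ℓ * (r + s) - s)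
    (fun c hc hne => by have := hC.weight c hc hne; omega) hS
  omega

/-- No chain of repair sets has more redundancy than one of disjoint repair sets. -/
theorem false_of_excess_redundancy (hC : IsTightLRC C ℓ r s) (hr : 0 < r) (k : ℕ) :
    ∀ (j : ℕ), j + k + 1 = ℓ → ∀ U : Finset ι,
      (k + 1) * r ≤ Module.finrank F (vanishingSubcode C U) →
      ℓ * r + j * s + 1 ≤ U.card + Module.finrank F (vanishingSubcode C U) → False := by
  induction k with
  | zero =>
    rintro j rfl U h1 h2
    have := hC.card_add_finrank_add_le (S := U) (by omega)
    simp only [add_mul, mul_add] at *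
    omega
  | succ k ih =>
    rintro j hj U h1 h2
    have h0 : (k + 1 + 1) * r = (k + 1) * r + r := by ring
    -- Adding `R` keeps the excess: redundancy grows by at least `s`, and since `R` has at most `r +
    -- s` elements the dimension drops by at most `r`.
    obtain ⟨R, hR, h3⟩ := hC.exists_repairSet_step (U := U) (by omega)
    have h4 := Finset.card_le_card (Finset.sdiff_subset (s := R) (t := U))
    have h5 := Finset.card_sdiff_add_card R U
    rw [Finset.union_comm] at h5
    refine ih (j + 1) (by omega) (U ∪ R) (by omega) ?_
    rw [add_mul j]
    omega

/-- A set no larger than `j` blocks with the redundancy of `j` blocks is extremal. Extending it by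
repair sets up to `j = ℓ` exhausts the code, since redundancy `ℓ s` exceeds what a surviving
codeword allows; there size and dimension are forced, and the equalities pass back down the chain.
-/
theorem card_eq_and_finrank_eq (hC : IsTightLRC C ℓ r s) (hr : 0 < r) (hs : 0 < s) (k : ℕ) :
    ∀ j : ℕ, j + k = ℓ → ∀ U : Finset ι, U.card ≤ j * (r + s) →
      ℓ * r + j * s ≤ U.card + Module.finrank F (vanishingSubcode C U) →
      U.card = j * (r + s) ∧ Module.finrank F (vanishingSubcode C U) = k * r := by
  induction k with
  | zero =>
    rintro j rfl U h1 h2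
    have : ¬ 0 < Module.finrank F (vanishingSubcode C U) := fun h => by
      have := hC.card_add_finrank_add_le h
      simp only [add_mul, mul_add] at *
      omega
    simp only [add_mul, mul_add] at *
    omega
  | succ k ih =>
    rintro j rfl U h1 h2
    have h0 : (k + 1) * r = k * r + r := by ring
    have h3 : (k + 1) * r ≤ Module.finrank F (vanishingSubcode C U) := by
      simp only [add_mul, mul_add] at *
      omega
    obtain ⟨R, hR, h4⟩ := hC.exists_repairSet_step (U := U) (by omega)
    have h5 := Finset.card_le_card (Finset.sdiff_subset (s := R) (t := U))
    have h6 := Finset.card_sdiff_add_card R U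
    rw [Finset.union_comm] at h6
    have h7 : (j + 1) * (r + s) = j * (r + s) + (r + s) := by ring
    have h9 : (j + 1) * s = j * s + s := by ring
    have h8 := ih (j + 1) (by omega) (U ∪ R) (by omega) (by omega)
    omega

/-- A coordinate that is always zero would be a set of redundancy one and rank zero, which is excess
with `j = 0`. -/
theorem exists_ne_zero (hC : IsTightLRC C ℓ r s) (hr : 0 < r) (hℓ : 0 < ℓ) (i : ι) :
    ∃ c ∈ C, c i ≠ 0 := by
  by_contra! h
  have h1 : vanishingSubcode C {i} = C := by
    ext c
    rw [mem_vanishingSubcode]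
    refine ⟨fun h => h.1, fun hc => ⟨hc, fun j hj => ?_⟩⟩
    rw [Finset.mem_singleton.mp hj]
    exact h c hc
  refine hC.false_of_excess_redundancy hr (ℓ - 1) 0 (by omega) {i} ?_ ?_
  · rw [h1, hC.dim_eq, Nat.sub_add_cancel hℓ]
  · rw [h1, hC.dim_eq, Finset.card_singleton]
    omega

theorem redundancy_of_repairSet (hC : IsTightLRC C ℓ r s) (hr : 0 < r) (hs : 0 < s)
    (hℓ : 0 < ℓ) {i : ι}
    {R : Finset ι} (hi : i ∈ R) (hR : IsRepairSet C (r + s) (s + 1) R) :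
    R.card = r + s ∧ Module.finrank F (vanishingSubcode C R) = (ℓ - 1) * r := by
  obtain ⟨c, hc, hci⟩ := hC.exists_ne_zero hr hℓ i
  have h1 := (hR.finrank_vanishingSubcode_union ∅).resolve_left fun h => by
    have := finrank_vanishingSubcode_lt (C := C) (Finset.subset_union_left (s₁ := ∅) (s₂ := R))
      (by rwa [vanishingSubcode_empty]) (Finset.mem_union_right ∅ hi) hci
    omega
  rw [Finset.empty_union, vanishingSubcode_empty, hC.dim_eq, Finset.sdiff_empty] at h1
  have := hC.card_eq_and_finrank_eq hr hs (ℓ - 1) 1 (by omega) R (by simpa using hR.1) (by omega)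
  simpa using this

theorem repairSet_eq_or_disjoint (hC : IsTightLRC C ℓ r s) (hr : 0 < r) (hs : 0 < s)
    (hℓ : 0 < ℓ)
    (h_card : ℓ = 1 → Fintype.card ι = r + s) {i j : ι}
    {R T : Finset ι} (hi : i ∈ R) (hR : IsRepairSet C (r + s) (s + 1) R)
    (hj : j ∈ T) (hT : IsRepairSet C (r + s) (s + 1) T) : R = T ∨ Disjoint R T := by
  obtain ⟨h1, h2⟩ := hC.redundancy_of_repairSet hr hs hℓ hi hR
  obtain ⟨h3, h4⟩ := hC.redundancy_of_repairSet hr hs hℓ hj hT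
  -- For `ℓ = 1` there is no room for a chain of two repair sets, and overlaps are excluded only
  -- because each repair set is the whole coordinate set.
  by_cases hℓ1 : ℓ = 1
  · left
    rw [(Finset.card_eq_iff_eq_univ R).mp (by rw [h1, h_card hℓ1]),
      (Finset.card_eq_iff_eq_univ T).mp (by rw [h3, h_card hℓ1])]
  have h5 := Finset.card_sdiff_add_card T R
  rw [Finset.union_comm] at h5
  obtain ⟨k, rfl⟩ : ∃ k, ℓ = k + 2 := ⟨ℓ - 2, by omega⟩
  have h0 : (k + 2 - 1) * r = (k + 1) * r := rfl
  have h0' : (k + 2) * r = (k + 1) * r + r := by ring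
  -- If `T` costs no dimension, every coordinate of `T \ R` is extra redundancy, so there is none.
  -- Otherwise `R ∪ T` has redundancy `2 s`, hence size `2 (r + s)`.
  rcases hT.finrank_vanishingSubcode_union R with h | h
  · left
    by_contra hne
    refine hC.false_of_excess_redundancy hr k 1 (by omega) (R ∪ T) (by omega) ?_
    have h6 : 0 < (T \ R).card := by
      rw [Finset.card_pos, Finset.sdiff_nonempty]
      exact fun h => hne (Finset.eq_of_subset_of_card_le h (by omega)).symm
    omega
  · right
    have h6 := Finset.card_le_card (Finset.sdiff_subset (s := T) (t := R))
    have := hC.card_eq_and_finrank_eq hr hs k 2 (by omega) (R ∪ T) (by omega) (by omega)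
    rw [← Finset.card_union_eq_card_add_card]
    omega

/-- The repair sets partition the coordinates into blocks of size `r + s`. -/
theorem exists_blocks (hC : IsTightLRC C ℓ r s) (hr : 0 < r) (hs : 0 < s)
    (hℓ : 0 < ℓ) {g : ℕ}
    (hg : ℓ = 1 → g = 1) (h_card : Fintype.card ι = g * (r + s)) :
    ∃ e : ι ≃ Fin (r + s) × Fin g,
      ∀ p, IsRepairSet C (r + s) (s + 1) (Finset.univ.filter fun x => (e x).2 = p) := by
  choose R hiR hR using hC.repair
  have hRc i := (hC.redundancy_of_repairSet hr hs hℓ (hiR i) (hR i)).1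
  have h_or i j := hC.repairSet_eq_or_disjoint hr hs hℓ (fun h => by rw [h_card, hg h, one_mul])
    (hiR i) (hR i) (hiR j) (hR j)
  have h_mem i j : j ∈ R i ↔ R j = R i := by
    refine ⟨fun h => ?_, fun h => h ▸ hiR j⟩
    exact (h_or j i).resolve_right fun hd => Finset.disjoint_left.mp hd (hiR j) h
  -- The blocks are the fibres of `i ↦ R i`, and each fibre is the repair set it is sent to.
  have h_fib (b : Finset.univ.image R) :
      Finset.univ.filter (fun i => R i = b) = (b : Finset ι) := by
    obtain ⟨b, hb⟩ := b
    obtain ⟨i, -, rfl⟩ := Finset.mem_image.mp hb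
    ext j
    simp [h_mem]
  have h_fibc (b : Finset.univ.image R) :
      Fintype.card {i // (⟨R i, Finset.mem_image_of_mem R (Finset.mem_univ i)⟩ :
        Finset.univ.image R) = b} = r + s := by
    have h1 : (b : Finset ι).card = r + s := by
      obtain ⟨b, hb⟩ := b
      obtain ⟨i, -, rfl⟩ := Finset.mem_image.mp hb
      exact hRc i
    rw [Fintype.card_subtype, ← h1, ← h_fib b]
    simp [Subtype.ext_iff]
  let e₁ : ι ≃ Fin (r + s) × Finset.univ.image R :=
    (Equiv.sigmaFiberEquiv fun i => (⟨R i, Finset.mem_image_of_mem R (Finset.mem_univ i)⟩ :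
      Finset.univ.image R)).symm.trans
      ((Equiv.sigmaCongrRight fun b => Fintype.equivFinOfCardEq (h_fibc b)).trans
        ((Equiv.sigmaEquivProd _ _).trans (Equiv.prodComm _ _)))
  have he₁ i : ((e₁ i).2 : Finset ι) = R i := rfl
  have h_num : Fintype.card (Finset.univ.image R) = g := by
    have h1 := Fintype.card_congr e₁
    rw [Fintype.card_prod, Fintype.card_fin, h_card, mul_comm] at h1
    exact (Nat.eq_of_mul_eq_mul_left (by omega) h1).symm
  let e₂ := Fintype.equivFinOfCardEq h_num
  refine ⟨e₁.trans (Equiv.prodCongr (Equiv.refl _) e₂), fun p => ?_⟩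
  have h2 : Finset.univ.filter (fun x => ((e₁.trans (Equiv.prodCongr (Equiv.refl _) e₂)) x).2 = p)
      = (e₂.symm p : Finset ι) := by
    rw [← h_fib]
    ext i
    rw [Finset.mem_filter, Finset.mem_filter, ← he₁ i, ← Subtype.ext_iff, Equiv.eq_symm_apply]
    rfl
  rw [h2]
  obtain ⟨b, hb⟩ := e₂.symm p
  obtain ⟨i, -, rfl⟩ := Finset.mem_image.mp hb
  exact hR i

end IsTightLRC

/-! ### The Singleton-type bound for dimension `κ r`, and relabelling of coordinates. -/

/-- The case `κ = 0` is included because the cost bounds for `t = 1` use `(t - 1) * k = 0`. -/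
theorem localityDefect_mul (κ r s : ℕ) (hr : 0 < r) :
    localityDefect (κ * r) r (s + 1) = ((κ : ℤ) - 1) * s := by
  have hr' : (r : ℚ) ≠ 0 := by positivity
  simp [localityDefect, hr']

section Relabel

variable {F ι κ : Type*} [Field F]

theorem finrank_map_funLeft_equiv [Fintype ι] [Fintype κ] (e : κ ≃ ι) (C : Submodule F (ι → F)) :
    Module.finrank F (C.map (LinearMap.funLeft F F e)) = Module.finrank F C :=
  LinearEquiv.finrank_map_eq (LinearEquiv.funCongrLeft F F e) C

variable [DecidableEq F]

theorem minDistAtLeast_puncturedCode_iff (C : Submodule F (ι → F)) (δ : ℕ) (R : Finset ι) :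
    MinDistAtLeast (puncturedCode C R) δ ↔
      ∀ c ∈ C, (∃ i ∈ R, c i ≠ 0) → δ ≤ (R.filter fun i => c i ≠ 0).card := by
  have h1 (c : ι → F) : hammingNorm (fun i : {i // i ∈ R} => c i) =
      (R.filter fun i => c i ≠ 0).card := by
    rw [hammingNorm, ← Finset.card_map (Function.Embedding.subtype _)]
    congr 1
    ext i
    simp [and_comm]
  constructor
  · rintro h c hc ⟨i, hi, hci⟩
    rw [← h1]
    exact h _ (Submodule.mem_map_of_mem hc) fun h0 => hci (congrFun h0 ⟨i, hi⟩)
  · rintro h _ ⟨c, hc, rfl⟩ hne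
    obtain ⟨i, hi⟩ := Function.ne_iff.mp hne
    exact (h c hc ⟨i, i.2, hi⟩).trans_eq (h1 c).symm

theorem hasAllSymbolLocality_iff (C : Submodule F (ι → F)) (r s : ℕ) :
    HasAllSymbolLocality C r (s + 1) ↔
      ∀ i, ∃ R, i ∈ R ∧ IsRepairSet C (r + s) (s + 1) R := by
  simp only [HasAllSymbolLocality, minDistAtLeast_puncturedCode_iff]
  rfl

theorem IsRepairSet.of_map {C : Submodule F (ι → F)} {m δ : ℕ} (φ : κ ↪ ι) {T : Finset κ}
    (h : IsRepairSet C m δ (T.map φ)) : IsRepairSet (C.map (LinearMap.funLeft F F φ)) m δ T := by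
  refine ⟨by simpa using h.1, ?_⟩
  rintro _ ⟨c, hc, rfl⟩ ⟨i, hi, hci⟩
  have := h.2 c hc ⟨φ i, Finset.mem_map_of_mem φ hi, hci⟩
  rwa [Finset.filter_map, Finset.card_map] at this

theorem hammingNorm_comp_equiv [Fintype ι] [Fintype κ] (e : κ ≃ ι) (c : ι → F) :
    hammingNorm (c ∘ e) = hammingNorm c := by
  rw [hammingNorm, hammingNorm, ← Finset.card_map e.toEmbedding]
  congr 1
  ext i
  simp

theorem IsTightLRC.map_equiv [Fintype ι] [Fintype κ] {C : Submodule F (ι → F)} {ℓ r s : ℕ}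
    (hC : IsTightLRC C ℓ r s) (e : κ ≃ ι) :
    IsTightLRC (C.map (LinearMap.funLeft F F e)) ℓ r s where
  dim_eq := by rw [finrank_map_funLeft_equiv, hC.dim_eq]
  weight := by
    rintro _ ⟨c, hc, rfl⟩ hne
    rw [Fintype.card_congr e]
    refine (hC.weight c hc ?_).trans_eq ?_
    · rintro rfl
      exact hne (map_zero _)
    · rw [← hammingNorm_comp_equiv e]
      rfl
  repair := fun i => by
    obtain ⟨R, hi, hR⟩ := hC.repair (e i)
    refine ⟨R.map e.symm.toEmbedding, by simpa using hi, ?_⟩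
    apply IsRepairSet.of_map e.toEmbedding
    convert hR
    ext j
    simp

theorem IsOptimalLRC.isTightLRC {n ℓ d r s : ℕ} (hr : 0 < r) {C : Submodule F (Fin n → F)}
    (hC : IsOptimalLRC C (ℓ * r) d r (s + 1)) : IsTightLRC C ℓ r s where
  dim_eq := hC.dim_eq
  weight := fun c hc hne => by
    have h1 := hC.minDist.2 ⟨c, hc, hne, rfl⟩
    have h2 := hC.attains
    rw [singletonTypeBound, localityDefect_mul _ _ _ hr] at h2
    rw [Fintype.card_fin]
    zify at h1 ⊢
    push_cast at h2
    linarith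
  repair := (hasAllSymbolLocality_iff C r s).mp hC.locality

/-- Tight parameters bound the distance only from below; the light codeword `hw` makes it exact. -/
theorem IsTightLRC.isOptimalLRC {n ℓ r s : ℕ} (hr : 0 < r) {C : Submodule F (Fin n → F)}
    (hC : IsTightLRC C ℓ r s) (hn : ℓ * (r + s) ≤ n)
    (hw : ∃ c ∈ C, c ≠ 0 ∧ hammingNorm c + ℓ * (r + s) ≤ n + (s + 1)) :
    IsOptimalLRC C (ℓ * r) (n - ℓ * (r + s) + (s + 1)) r (s + 1) where
  dim_eq := hC.dim_eq
  locality := (hasAllSymbolLocality_iff C r s).mpr hC.repair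
  minDist := by
    have h0 := hC.weight
    rw [Fintype.card_fin] at h0
    constructor
    · obtain ⟨c, hc, hne, h⟩ := hw
      have := h0 c hc hne
      exact ⟨c, hc, hne, by omega⟩
    · rintro _ ⟨c, hc, hne, rfl⟩
      have := h0 c hc hne
      omega
  attains := by
    rw [singletonTypeBound, localityDefect_mul _ _ _ hr]
    push_cast [hn]
    ring

end Relabel

/-! ### Codes arranged in blocks. -/

/-- A code of tight parameters whose coordinates are arranged in blocks of size `r + s`, each of
which is a repair set. -/
structure IsBlockLRC {F P : Type*} [Field F] [DecidableEq F] [Fintype P] {r s : ℕ}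
    (D : Submodule F (Fin (r + s) × P → F)) (ℓ : ℕ) : Prop where
  dim_eq : Module.finrank F D = ℓ * r
  weight : ∀ c ∈ D, c ≠ 0 →
    Fintype.card P * (r + s) + (s + 1) ≤ hammingNorm c + ℓ * (r + s)
  repair : ∀ p, IsRepairSet D (r + s) (s + 1) (Finset.univ ×ˢ {p})

theorem IsTightLRC.isBlockLRC {F ι P : Type*} [Field F] [DecidableEq F] [Fintype ι] [Fintype P]
    [DecidableEq P] {C : Submodule F (ι → F)} {ℓ r s : ℕ} (hC : IsTightLRC C ℓ r s)
    (e : ι ≃ Fin (r + s) × P)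
    (he : ∀ p, IsRepairSet C (r + s) (s + 1) (Finset.univ.filter fun x => (e x).2 = p)) :
    IsBlockLRC (C.map (LinearMap.funLeft F F e.symm)) ℓ where
  dim_eq := (hC.map_equiv e.symm).dim_eq
  weight := fun c hc hne => by
    have := (hC.map_equiv e.symm).weight c hc hne
    rwa [Fintype.card_prod, Fintype.card_fin, mul_comm] at this
  repair := fun p => by
    apply IsRepairSet.of_map e.symm.toEmbedding
    convert he p
    ext i
    constructor
    · intro h
      obtain ⟨⟨x, q⟩, h, rfl⟩ := Finset.mem_map.mp h
      simp_all
    · intro h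
      exact Finset.mem_map.mpr ⟨e i, Finset.mem_product.mpr ⟨Finset.mem_univ _,
        Finset.mem_singleton.mpr (Finset.mem_filter.mp h).2⟩, by simp⟩

namespace IsBlockLRC

variable {F P : Type*} [Field F] [DecidableEq F] [Fintype P] {r s ℓ : ℕ}
  {D : Submodule F (Fin (r + s) × P → F)}

theorem isTightLRC (hD : IsBlockLRC D ℓ) : IsTightLRC D ℓ r s where
  dim_eq := hD.dim_eq
  weight := fun c hc hne => by
    rw [Fintype.card_prod, Fintype.card_fin, mul_comm]
    exact hD.weight c hc hne
  repair := fun i => ⟨Finset.univ ×ˢ {i.2}, by simp, hD.repair i.2⟩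

/-- A codeword is zero on a block as soon as it is zero on `r` of its coordinates. -/
theorem eq_zero_of_prefix (hD : IsBlockLRC D ℓ) {c : Fin (r + s) × P → F} (hc : c ∈ D) {p : P}
    (h : ∀ x : Fin (r + s), (x : ℕ) < r → c (x, p) = 0) (x : Fin (r + s)) : c (x, p) = 0 := by
  by_contra hne
  have h1 := (hD.repair p).2 c hc ⟨(x, p), by simp, hne⟩
  -- Only the last `s` coordinates of the block can be nonzero, which is fewer than the local
  -- distance `s + 1`.
  have h2 : ((Finset.univ ×ˢ {p}).filter fun i => c i ≠ 0) ⊆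
      (Finset.univ.map (Fin.natAddEmb r)).map 
        ⟨fun x => (x, p), fun _ _ h => (Prod.ext_iff.mp h).1⟩ := by
    rintro ⟨y, q⟩ hy
    simp only [Finset.mem_filter, Finset.mem_product, Finset.mem_singleton, Finset.mem_univ,
      true_and] at hy
    obtain ⟨rfl, hy⟩ := hy
    have : r ≤ (y : ℕ) := by
      by_contra hlt
      exact hy (h y (by omega))
    simp only [Finset.mem_map, Finset.mem_univ, true_and, exists_exists_eq_and]
    exact ⟨⟨y - r, by omega⟩, Prod.ext (Fin.ext (Nat.add_sub_of_le this)) rfl⟩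
  have h3 := Finset.card_le_card h2
  simp only [Finset.card_map, Finset.card_univ, Fintype.card_fin] at h3
  omega

variable [DecidableEq P]

/-- Each block costs at most `r` dimensions, so the union has at least the extremal redundancy `|Q|
s`, and rigidity gives equality. -/
theorem finrank_vanishingSubcode_blocks (hD : IsBlockLRC D ℓ) (hr : 0 < r) (hs : 0 < s)
    {Q : Finset P} (hQ : Q.card ≤ ℓ) :
    Module.finrank F (vanishingSubcode D (Finset.univ ×ˢ Q)) = (ℓ - Q.card) * r := by
  have h1 : ∀ Q : Finset P, ℓ * r ≤
      Module.finrank F (vanishingSubcode D (Finset.univ ×ˢ Q)) + Q.card * r := fun Q => by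
    induction Q using Finset.induction_on with
    | empty =>
      rw [Finset.product_empty, vanishingSubcode_empty, hD.dim_eq]
      exact Nat.le_add_right _ _
    | insert p Q hp ih =>
      have := (hD.repair p).finrank_vanishingSubcode_le (Finset.univ ×ˢ Q)
      rw [← Finset.product_union, Finset.union_singleton] at this
      rw [Finset.card_insert_of_notMem hp, add_mul]
      omega
  have h2 : (Finset.univ ×ˢ Q : Finset (Fin (r + s) × P)).card = Q.card * (r + s) := by
    rw [Finset.card_product, Finset.card_univ, Fintype.card_fin, mul_comm]
  refine (hD.isTightLRC.card_eq_and_finrank_eq hr hs (ℓ - Q.card) Q.card (by omega) _ h2.le ?_).2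
  rw [h2, mul_add]
  have := h1 Q
  omega

/-- Vanishing on `ℓ - 1` blocks leaves dimension `r`, so `r - 1` further coordinates can be killed
while a nonzero codeword survives; its number of zeros matches the Singleton-type bound. -/
theorem exists_weight_le (hD : IsBlockLRC D ℓ) (hr : 0 < r) (hs : 0 < s) (hℓ : 0 < ℓ)
    (hP : ℓ ≤ Fintype.card P) :
    ∃ c ∈ D, c ≠ 0 ∧ hammingNorm c + ℓ * (r + s) ≤ Fintype.card P * (r + s) + (s + 1) := by
  obtain ⟨k, rfl⟩ : ∃ k, ℓ = k + 1 := ⟨ℓ - 1, by omega⟩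
  obtain ⟨Q, -, hQ⟩ := Finset.exists_subset_card_eq
    (show k ≤ (Finset.univ : Finset P).card by rw [Finset.card_univ]; omega)
  have h1 := hD.finrank_vanishingSubcode_blocks hr hs (Q := Q) (by omega)
  set U : Finset (Fin (r + s) × P) := Finset.univ ×ˢ Q
  have h2 : U.card = k * (r + s) := by
    rw [Finset.card_product, Finset.card_univ, Fintype.card_fin, mul_comm, hQ]
  have h3 := U.card_add_card_compl
  rw [Fintype.card_prod, Fintype.card_fin, mul_comm (r + s)] at h3
  have h4 := Nat.mul_le_mul_right (r + s) hP
  rw [add_mul, one_mul] at h4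
  obtain ⟨T, hT, hTc⟩ := Finset.exists_subset_card_eq (show r - 1 ≤ Uᶜ.card by omega)
  have h5 := finrank_vanishingSubcode_le (C := D) U T
  rw [hQ, show k + 1 - k = 1 by omega, one_mul] at h1
  obtain ⟨c, hc, i, hi⟩ := exists_ne_zero_of_finrank_vanishingSubcode_pos
    (show 0 < Module.finrank F (vanishingSubcode D (U ∪ T)) by omega)
  rw [mem_vanishingSubcode] at hc
  refine ⟨c, hc.1, fun h => hi (by simp [h]), ?_⟩
  have h6 : hammingNorm c ≤ (U ∪ T)ᶜ.card := Finset.card_le_card fun j hj => by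
    rw [Finset.mem_compl]
    intro hjS
    simp [hc.2 j hjS] at hj
  have h7 := (U ∪ T).card_add_card_compl
  rw [Finset.card_union_of_disjoint (Finset.disjoint_of_subset_right hT disjoint_compl_right),
    Fintype.card_prod, Fintype.card_fin, mul_comm (r + s)] at h7
  rw [add_mul, one_mul]
  omega

theorem isOptimalLRC_map (hD : IsBlockLRC D ℓ) (hr : 0 < r) (hs : 0 < s) (hℓ : 0 < ℓ) {u : ℕ}
    (hP : ℓ ≤ u) (hu : Fintype.card P = u) (e : Fin (u * (r + s)) ≃ Fin (r + s) × P) :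
    IsOptimalLRC (D.map (LinearMap.funLeft F F e)) (ℓ * r) ((u - ℓ) * (r + s) + (s + 1)) r
      (s + 1) := by
  obtain ⟨c, hc, hne, hw⟩ := hD.exists_weight_le hr hs hℓ (hu ▸ hP)
  rw [Nat.sub_mul]
  refine (hD.isTightLRC.map_equiv e).isOptimalLRC hr (Nat.mul_le_mul_right _ hP)
    ⟨_, Submodule.mem_map_of_mem hc, ?_, ?_⟩
  · intro h
    exact hne ((LinearEquiv.funCongrLeft F F e).map_eq_zero_iff.mp h)
  · rw [hu] at hw
    refine le_trans (le_of_eq ?_) hw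
    rw [← hammingNorm_comp_equiv e]
    rfl

end IsBlockLRC

/-! ### The block parity check matrix. -/

section ParityCheck

open scoped Matrix

theorem exists_linearMap_ker_eq {F V : Type*} [Field F] [AddCommGroup V] [Module F V]
    [FiniteDimensional F V] (W : Submodule F V) {b : ℕ}
    (h : Module.finrank F V ≤ Module.finrank F W + b) :
    ∃ f : V →ₗ[F] (Fin b → F), LinearMap.ker f = W := by
  have h1 := W.finrank_quotient_add_finrank
  have h2 : Module.finrank F (V ⧸ W) ≤ Module.finrank F (Fin b → F) := by
    rw [Module.finrank_fin_fun]; omega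
  obtain ⟨f, hf⟩ := finrank_le_iff_exists_linearMap.mp h2
  refine ⟨f ∘ₗ W.mkQ, ?_⟩
  rw [LinearMap.ker_comp_of_ker_eq_bot _ (LinearMap.ker_eq_bot.mpr hf), Submodule.ker_mkQ]

theorem mem_codeOfParityCheck_block {F P : Type*} [Field F] [Fintype P] [DecidableEq P]
    {a b m : ℕ} {A : P → Matrix (Fin a) (Fin m) F} {B : P → Matrix (Fin b) (Fin m) F}
    {c : Fin m × P → F} :
    c ∈ codeOfParityCheck (blockParityCheck A B) ↔
      (∀ p, A p *ᵥ (fun x => c (x, p)) = 0) ∧ ∑ p, B p *ᵥ (fun x => c (x, p)) = 0 := by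
  rw [codeOfParityCheck, LinearMap.mem_ker, Matrix.mulVecLin_apply, blockParityCheck,
    Matrix.fromRows_mulVec]
  have h1 (y : Fin a) (p : P) : (Matrix.blockDiagonal A *ᵥ c) (y, p) =
      (A p *ᵥ fun x => c (x, p)) y := by
    simp [Matrix.mulVec, dotProduct, Matrix.blockDiagonal_apply, Fintype.sum_prod_type]
  have h2 (y : Fin b) : ((Matrix.of fun y xp => B xp.2 y xp.1) *ᵥ c) y =
      (∑ p, B p *ᵥ fun x => c (x, p)) y := by
    simp only [Matrix.mulVec, dotProduct, Matrix.of_apply, Finset.sum_apply]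
    rw [Fintype.sum_prod_type, Finset.sum_comm]
  constructor
  · intro h
    exact ⟨fun p => funext fun y => (h1 y p).symm.trans (congrFun h (Sum.inl (y, p))),
      funext fun y => (h2 y).symm.trans (congrFun h (Sum.inr y))⟩
  · rintro ⟨h3, h4⟩
    ext (⟨y, p⟩ | y)
    · exact (h1 y p).trans (congrFun (h3 p) y)
    · exact (h2 y).trans (congrFun h4 y)

namespace IsBlockLRC

variable {F P : Type*} [Field F] [DecidableEq F] [Fintype P] [DecidableEq P] {r s ℓ : ℕ}
  {D : Submodule F (Fin (r + s) × P → F)}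

theorem finrank_block (hD : IsBlockLRC D ℓ) (hr : 0 < r) (hs : 0 < s) (hℓ : 0 < ℓ) (p : P) :
    Module.finrank F (D.map (LinearMap.funLeft F F fun x : Fin (r + s) => (x, p))) = r := by
  have h1 := LinearMap.finrank_range_add_finrank_ker
    ((LinearMap.funLeft F F fun x : Fin (r + s) => (x, p)).domRestrict D)
  rw [LinearMap.range_domRestrict, hD.dim_eq] at h1
  have h2 : Module.finrank F (LinearMap.ker
      ((LinearMap.funLeft F F fun x : Fin (r + s) => (x, p)).domRestrict D)) =
      Module.finrank F (vanishingSubcode D (Finset.univ ×ˢ {p})) := by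
    have h3 : (LinearMap.ker
        ((LinearMap.funLeft F F fun x : Fin (r + s) => (x, p)).domRestrict D)).map D.subtype =
        vanishingSubcode D (Finset.univ ×ˢ {p}) := by
      ext c
      rw [mem_vanishingSubcode]
      constructor
      · rintro ⟨⟨c, hc⟩, h, rfl⟩
        refine ⟨hc, ?_⟩
        rintro ⟨x, q⟩ hx
        obtain rfl : q = p := Finset.mem_singleton.mp (Finset.mem_product.mp hx).2
        exact congrFun h x
      · rintro ⟨hc, h⟩
        exact ⟨⟨c, hc⟩, funext fun x => h (x, p) (by simp), rfl⟩
    rw [← Submodule.finrank_map_subtype_eq, h3]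
  rw [h2, hD.finrank_vanishingSubcode_blocks hr hs (by rwa [Finset.card_singleton]),
    Finset.card_singleton] at h1
  obtain ⟨k, rfl⟩ : ∃ k, ℓ = k + 1 := ⟨ℓ - 1, by omega⟩
  rw [Nat.add_sub_cancel, add_mul] at h1
  omega

theorem exists_parityCheck (hD : IsBlockLRC D ℓ) (hr : 0 < r) (hs : 0 < s) (hℓ : 0 < ℓ)
    (hP : ℓ ≤ Fintype.card P) :
    ∃ (A : P → Matrix (Fin s) (Fin (r + s)) F)
      (B : P → Matrix (Fin ((Fintype.card P - ℓ) * r)) (Fin (r + s)) F),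
      codeOfParityCheck (blockParityCheck A B) = D := by
  have hA p : ∃ A : Matrix (Fin s) (Fin (r + s)) F, LinearMap.ker A.mulVecLin =
      D.map (LinearMap.funLeft F F fun x : Fin (r + s) => (x, p)) := by
    obtain ⟨f, hf⟩ := exists_linearMap_ker_eq (b := s)
      (D.map (LinearMap.funLeft F F fun x : Fin (r + s) => (x, p)))
      (by rw [hD.finrank_block hr hs hℓ, Module.finrank_fin_fun])
    exact ⟨LinearMap.toMatrix' f, by rw [← Matrix.toLin'_apply', Matrix.toLin'_toMatrix', hf]⟩
  choose A hA using hA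
  -- The product of the local codes: all words satisfying the equations of the `A p` alone.
  let W : Submodule F (Fin (r + s) × P → F) :=
    ⨅ p, (LinearMap.ker (A p).mulVecLin).comap (LinearMap.funLeft F F fun x => (x, p))
  have hWmem c : c ∈ W ↔ ∀ p, A p *ᵥ (fun x => c (x, p)) = 0 := by
    simp only [W, Submodule.mem_iInf, Submodule.mem_comap, LinearMap.mem_ker,
      Matrix.mulVecLin_apply]
    rfl
  have hDW : D ≤ W := fun c hc => by
    simp only [W, Submodule.mem_iInf, Submodule.mem_comap, hA]
    exact fun p => Submodule.mem_map_of_mem hc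
  have hW : Module.finrank F W ≤ Fintype.card P * r := by
    let f : W →ₗ[F] (∀ p, LinearMap.ker (A p).mulVecLin) :=
      LinearMap.pi fun p => LinearMap.codRestrict _
        ((LinearMap.funLeft F F fun x => (x, p)).domRestrict W)
        fun c => ((Submodule.mem_iInf _).mp c.2 p)
    have hf : Function.Injective f := fun c c' h => by
      ext ⟨x, p⟩
      exact congrFun (congrArg Subtype.val (congrFun h p)) x
    refine (LinearMap.finrank_le_finrank_of_injective hf).trans ?_
    rw [Module.finrank_pi_fintype]
    exact (Finset.sum_congr rfl fun p _ => by rw [hA, hD.finrank_block hr hs hℓ]).trans_le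
      (by simp)
  obtain ⟨f, hf⟩ := exists_linearMap_ker_eq (b := (Fintype.card P - ℓ) * r)
    (D.comap W.subtype) (by
      rw [(Submodule.comapSubtypeEquivOfLe hDW).finrank_eq, hD.dim_eq, ← add_mul,
        Nat.add_sub_cancel' hP]
      exact hW)
  -- The global equations are defined on `W`. Any extension to all words splits over the blocks, and
  -- `B p` is its restriction to words supported on block `p`.
  obtain ⟨f', hf'⟩ := f.exists_extend
  refine ⟨A, fun p => LinearMap.toMatrix' (f' ∘ₗ
    LinearMap.pi fun xp => if xp.2 = p then LinearMap.proj xp.1 else 0), ?_⟩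
  ext c
  rw [mem_codeOfParityCheck_block, ← hWmem]
  have hfc : ∑ p, (LinearMap.toMatrix' (f' ∘ₗ LinearMap.pi fun xp : Fin (r + s) × P =>
      if xp.2 = p then LinearMap.proj xp.1 else 0)) *ᵥ (fun x => c (x, p)) = f' c := by
    simp only [LinearMap.toMatrix'_mulVec, LinearMap.comp_apply, ← map_sum]
    congr 1
    ext ⟨x, p⟩
    simp [Finset.sum_apply, apply_ite, ite_apply]
  rw [hfc]
  constructor
  · rintro ⟨h1, h2⟩
    have : (⟨c, h1⟩ : W) ∈ LinearMap.ker f := by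
      rw [LinearMap.mem_ker, ← hf']
      exact h2
    rw [hf] at this
    exact this
  · intro h
    refine ⟨hDW h, ?_⟩
    have : (⟨c, hDW h⟩ : W) ∈ LinearMap.ker f := by
      rw [hf]
      exact h
    rw [LinearMap.mem_ker, ← hf'] at this
    exact this

end IsBlockLRC

end ParityCheck

/-! ### Shortening and puncturing by whole blocks. -/

/-- The inclusion of coordinates induced by an inclusion of blocks. -/
def blockEmbedding (m : ℕ) {P' P : Type*} (j : P' ↪ P) : Fin m × P' ↪ Fin m × P :=
  (Function.Embedding.refl (Fin m)).prodMap j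

theorem map_blockEmbedding {m : ℕ} {P' P : Type*} (j : P' ↪ P) (p : P') :
    (Finset.univ ×ˢ {p}).map (blockEmbedding m j) = Finset.univ ×ˢ {j p} := by
  ext ⟨x, q⟩
  simp only [Finset.mem_map, Finset.mem_product, Finset.mem_univ, true_and,
    Finset.mem_singleton]
  constructor
  · rintro ⟨⟨y, q'⟩, rfl, h⟩
    exact (Prod.ext_iff.mp h).2.symm
  · rintro rfl
    exact ⟨(x, p), rfl, rfl⟩

/-- Words on the blocks in `Q`, extended by zero to all blocks. -/
noncomputable def extendBlocks (F : Type*) [Field F] {P : Type*} (m : ℕ) (Q : Finset P) :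
    (Fin m × {p // p ∈ Q} → F) →ₗ[F] (Fin m × P → F) :=
  Function.ExtendByZero.linearMap F (blockEmbedding m (Function.Embedding.subtype (· ∈ Q)))

/-- The code `D` shortened to the blocks in `Q`. -/
noncomputable def shortenedCode {F P : Type*} [Field F] {m : ℕ} (D : Submodule F (Fin m × P → F))
    (Q : Finset P) : Submodule F (Fin m × {p // p ∈ Q} → F) :=
  D.comap (extendBlocks F m Q)

section ShortenedCode

variable {F P : Type*} [Field F] {m : ℕ} {Q : Finset P}

theorem extendBlocks_apply (c : Fin m × {p // p ∈ Q} → F) (x : Fin m) {p : P} (hp : p ∈ Q) :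
    extendBlocks F m Q c (x, p) = c (x, ⟨p, hp⟩) := by
  exact (blockEmbedding m (Function.Embedding.subtype (· ∈ Q))).injective.extend_apply c 0
    (x, ⟨p, hp⟩)

theorem extendBlocks_apply_of_notMem (c : Fin m × {p // p ∈ Q} → F) (x : Fin m) {p : P}
    (hp : p ∉ Q) : extendBlocks F m Q c (x, p) = 0 := by
  refine Function.extend_apply' (f := blockEmbedding m (Function.Embedding.subtype (· ∈ Q)))
    c 0 _ ?_
  rintro ⟨⟨y, q⟩, h⟩
  obtain rfl : (q : P) = p := (Prod.ext_iff.mp h).2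
  exact hp q.2

theorem extendBlocks_injective : Function.Injective (extendBlocks F m Q) := fun c c' h => by
  ext ⟨x, p, hp⟩
  rw [← extendBlocks_apply c x hp, h, extendBlocks_apply]

theorem hammingNorm_extendBlocks [DecidableEq F] [Fintype P] (c : Fin m × {p // p ∈ Q} → F) :
    hammingNorm (extendBlocks F m Q c) = hammingNorm c := by
  rw [hammingNorm, hammingNorm,
    ← Finset.card_map (blockEmbedding m (Function.Embedding.subtype (· ∈ Q)))]
  congr 1
  ext ⟨x, p⟩
  simp only [Finset.mem_filter, Finset.mem_univ, true_and, Finset.mem_map, Prod.exists]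
  constructor
  · intro h
    by_cases hp : p ∈ Q
    · rw [extendBlocks_apply _ _ hp] at h
      exact ⟨x, ⟨p, hp⟩, h, rfl⟩
    · exact absurd (extendBlocks_apply_of_notMem c x hp) h
  · rintro ⟨y, ⟨q, hq⟩, h, h'⟩
    obtain ⟨rfl, rfl⟩ := Prod.ext_iff.mp h'
    change extendBlocks F m Q c (y, q) ≠ 0
    rwa [extendBlocks_apply _ _ hq]

theorem shortenedCode_codeOfParityCheck [Fintype P] [DecidableEq P] {a b : ℕ}
    (A : P → Matrix (Fin a) (Fin m) F) (B : P → Matrix (Fin b) (Fin m) F) :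
    shortenedCode (codeOfParityCheck (blockParityCheck A B)) Q =
      codeOfParityCheck (blockParityCheck (fun p : {p // p ∈ Q} => A p) (fun p => B p)) := by
  ext c
  rw [shortenedCode, Submodule.mem_comap, mem_codeOfParityCheck_block, mem_codeOfParityCheck_block]
  have h1 (p : P) (hp : p ∈ Q) :
      (fun x => extendBlocks F m Q c (x, p)) = fun x => c (x, ⟨p, hp⟩) :=
    funext fun x => extendBlocks_apply c x hp
  have h2 (p : P) (hp : p ∉ Q) : (fun x => extendBlocks F m Q c (x, p)) = 0 :=
    funext fun x => extendBlocks_apply_of_notMem c x hp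
  refine and_congr ⟨fun h p => ?_, fun h p => ?_⟩ ?_
  · rw [← h1 p p.2]
    exact h p
  · by_cases hp : p ∈ Q
    · rw [h1 p hp]
      exact h ⟨p, hp⟩
    · rw [h2 p hp, Matrix.mulVec_zero]
  · rw [← Finset.sum_subset (Finset.subset_univ Q)
      (fun p _ hp => by rw [h2 p hp, Matrix.mulVec_zero]), ← Finset.sum_coe_sort]
    simp only [fun p : {p // p ∈ Q} => h1 p p.2]

end ShortenedCode

theorem IsRepairSet.mono {F ι : Type*} [Field F] [DecidableEq F] {C C' : Submodule F (ι → F)}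
    {m δ : ℕ} {R : Finset ι} (h : IsRepairSet C m δ R) (hC : C' ≤ C) : IsRepairSet C' m δ R :=
  ⟨h.1, fun c hc => h.2 c (hC hc)⟩

namespace IsBlockLRC

variable {F P : Type*} [Field F] [DecidableEq F] [Fintype P] [DecidableEq P] {r s ℓ : ℕ}
  {D : Submodule F (Fin (r + s) × P → F)}

/-- The minimum distance exceeds the number of coordinates in `|P| - ℓ` blocks, so these cannot
support a nonzero codeword. -/
theorem eq_zero_of_notMem (hD : IsBlockLRC D ℓ) {T : Finset P} (hT : T.card + ℓ ≤ Fintype.card P)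
    {c : Fin (r + s) × P → F} (hc : c ∈ D) (h : ∀ p ∉ T, ∀ x, c (x, p) = 0) : c = 0 := by
  by_contra hne
  have h1 := hD.weight c hc hne
  have h2 : hammingNorm c ≤ (Finset.univ ×ˢ T : Finset (Fin (r + s) × P)).card :=
    Finset.card_le_card fun ⟨x, p⟩ hxp => by
      simp only [Finset.mem_product, Finset.mem_univ, true_and]
      by_contra hp
      simp [h p hp x] at hxp
  rw [Finset.card_product, Finset.card_univ, Fintype.card_fin, mul_comm] at h2
  have h3 := Nat.mul_le_mul_right (r + s) hT
  rw [add_mul] at h3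
  omega

/-- Deleting `ℓ - κ` blocks lowers both the length and `ℓ (r + s)` by the same amount, so the weight
bound is inherited unchanged. -/
theorem shorten (hD : IsBlockLRC D ℓ) (hr : 0 < r) (hs : 0 < s) {Q : Finset P} {κ : ℕ}
    (hQ : Qᶜ.card + κ = ℓ) : IsBlockLRC (shortenedCode D Q) κ where
  dim_eq := by
    have h1 : (shortenedCode D Q).map (extendBlocks F (r + s) Q) =
        vanishingSubcode D (Finset.univ ×ˢ Qᶜ) := by
      ext c
      rw [mem_vanishingSubcode]
      constructor
      · rintro ⟨c, hc, rfl⟩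
        refine ⟨hc, ?_⟩
        rintro ⟨x, p⟩ hp
        exact extendBlocks_apply_of_notMem c x (by simpa using hp)
      · rintro ⟨hc, h⟩
        have h2 : extendBlocks F (r + s) Q (fun xp => c (xp.1, xp.2)) = c := by
          ext ⟨x, p⟩
          by_cases hp : p ∈ Q
          · rw [extendBlocks_apply _ _ hp]
          · rw [extendBlocks_apply_of_notMem _ _ hp, h _ (by simpa using hp)]
        exact ⟨fun xp => c (xp.1, xp.2), by
          change extendBlocks F (r + s) Q _ ∈ D
          rwa [h2], h2⟩
    rw [(Submodule.equivMapOfInjective _ extendBlocks_injective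
      (shortenedCode D Q)).finrank_eq, h1,
      hD.finrank_vanishingSubcode_blocks hr hs (by omega), ← hQ, Nat.add_sub_cancel_left]
  weight := fun c hc hne => by
    have h1 := hD.weight (extendBlocks F (r + s) Q c) hc
      (fun h => hne (extendBlocks_injective (h.trans (map_zero _).symm)))
    rw [hammingNorm_extendBlocks, ← hQ, ← Finset.card_add_card_compl Q, add_mul, add_mul] at h1
    rw [Fintype.card_coe]
    omega
  repair := fun p => by
    have h1 : shortenedCode D Q ≤ D.map (LinearMap.funLeft F F
        (blockEmbedding (r + s) (Function.Embedding.subtype (· ∈ Q)))) := fun c hc =>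
      ⟨_, hc, funext fun ⟨x, p, hp⟩ => extendBlocks_apply c x hp⟩
    refine (IsRepairSet.of_map _ ?_).mono h1
    rw [map_blockEmbedding]
    exact hD.repair p

/-- A codeword loses at most the deleted coordinates in weight; with `ℓ` blocks left it still has
weight at least `s + 1`, so puncturing is injective. -/
theorem map_blocks (hD : IsBlockLRC D ℓ) {P' : Type*} [Fintype P'] [DecidableEq P'] (j : P' ↪ P)
    (hP' : ℓ ≤ Fintype.card P') :
    IsBlockLRC (D.map (LinearMap.funLeft F F (blockEmbedding (r + s) j))) ℓ := by
  set φ := blockEmbedding (r + s) j with hφ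
  have h_le := Nat.mul_le_mul_right (r + s) hP'
  have h1 (c : Fin (r + s) × P → F) : hammingNorm c + Fintype.card P' * (r + s) ≤
      hammingNorm (c ∘ φ) + Fintype.card P * (r + s) := by
    have h2 : (Finset.univ.filter fun i => c i ≠ 0) ⊆
        (Finset.univ.filter fun i => c (φ i) ≠ 0).map φ ∪ (Finset.univ.map φ)ᶜ := fun i hi => by
      rw [Finset.mem_union]
      by_cases h : ∃ k, φ k = i
      · obtain ⟨k, rfl⟩ := h
        left
        exact Finset.mem_map_of_mem _ (by simpa using hi)
      · right
        simpa using h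
    have h3 := (Finset.card_le_card h2).trans (Finset.card_union_le _ _)
    have h4 := (Finset.univ.map φ).card_add_card_compl
    simp only [Finset.card_map, Finset.card_univ, Fintype.card_prod, Fintype.card_fin,
      mul_comm (r + s)] at h3 h4
    change hammingNorm c ≤ hammingNorm (c ∘ φ) + _ at h3
    omega
  refine ⟨?_, ?_, fun p => ?_⟩
  · rw [← hD.dim_eq]
    refine (LinearEquiv.finrank_eq (LinearEquiv.ofBijective
      ((LinearMap.funLeft F F φ).submoduleMap D) ⟨?_, LinearMap.submoduleMap_surjective _ _⟩)).symm
    rw [← LinearMap.ker_eq_bot, LinearMap.ker_eq_bot']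
    rintro ⟨c, hc⟩ h
    have h2 : c ∘ φ = 0 := congrArg Subtype.val h
    by_contra hne
    have h3 := hD.weight c hc (fun h => hne (Subtype.ext h))
    have h4 := h1 c
    rw [h2, hammingNorm_zero] at h4
    omega
  · rintro _ ⟨c, hc, rfl⟩ hne
    have h3 := hD.weight c hc (fun h => hne (by rw [h, map_zero]))
    have h4 := h1 c
    change _ ≤ hammingNorm (c ∘ φ) + _
    omega
  · apply IsRepairSet.of_map
    rw [hφ, map_blockEmbedding]
    exact hD.repair (j p)

/-- `D` is the direct sum of shortened codes whose supports have a small intersection. -/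
theorem exists_sum_extendBlocks_eq (hD : IsBlockLRC D ℓ) (hr : 0 < r) (hs : 0 < s) {t κ : ℕ}
    (ht : t * κ = ℓ) {Q : Fin t → Finset P} (hQ : ∀ i, (Q i)ᶜ.card + κ = ℓ) {T : Finset P}
    (hT : T.card + ℓ ≤ Fintype.card P) (h_inter : ∀ i j, i ≠ j → ∀ p ∈ Q i, p ∈ Q j → p ∈ T)
    {c : Fin (r + s) × P → F} (hc : c ∈ D) :
    ∃ x : ∀ i, Fin (r + s) × {p // p ∈ Q i} → F,
      (∀ i, x i ∈ shortenedCode D (Q i)) ∧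
      ∑ i, extendBlocks F (r + s) (Q i) (x i) = c := by
  let L : (∀ i, shortenedCode D (Q i)) →ₗ[F] D :=
    ∑ i, ((extendBlocks F (r + s) (Q i)).restrict (p := shortenedCode D (Q i)) (q := D)
      (fun _ h => h)) ∘ₗ LinearMap.proj i
  have hL x : (L x : Fin (r + s) × P → F) = ∑ i, extendBlocks F (r + s) (Q i) (x i) := by
    simp only [L, LinearMap.sum_apply, AddSubmonoidClass.coe_finsetSum]
    rfl
  -- Outside `T` a block belongs to at most one `Q i`. If the sum is zero, each summand is therefore
  -- supported on `T`, which is too small. Equality of dimensions then gives surjectivity.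
  have h_inj : Function.Injective L := by
    rw [← LinearMap.ker_eq_bot, LinearMap.ker_eq_bot']
    intro x hx
    have h0 : ∑ i, extendBlocks F (r + s) (Q i) (x i) = 0 := by rw [← hL, hx]; rfl
    ext1 i
    apply Subtype.ext
    refine extendBlocks_injective (Eq.trans ?_ (map_zero _).symm)
    refine hD.eq_zero_of_notMem hT (x i).2 fun p hp y => ?_
    by_cases hpi : p ∈ Q i
    · have h1 := congrFun h0 (y, p)
      rwa [Finset.sum_apply, Finset.sum_eq_single i ?_ (by simp)] at h1
      exact fun j _ hji => extendBlocks_apply_of_notMem _ _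
        fun hpj => hp (h_inter i j hji.symm p hpi hpj)
    · exact extendBlocks_apply_of_notMem _ _ hpi
  have h_surj : Function.Surjective L := by
    rw [← LinearMap.injective_iff_surjective_of_finrank_eq_finrank]
    · exact h_inj
    · rw [Module.finrank_pi_fintype, hD.dim_eq, ← ht]
      refine (Finset.sum_congr rfl fun i _ =>
        (hD.shorten hr hs (hQ i)).dim_eq).trans ?_
      simp [mul_assoc]
  obtain ⟨x, hx⟩ := h_surj ⟨c, hc⟩
  exact ⟨fun i => x i, fun i => (x i).2, by rw [← hL, hx]⟩

end IsBlockLRC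

/-! ### Counting the blocks of the initial codes. -/

section InitialBlocks

variable {g ℓ t w : ℕ}

theorem card_eq_of_mem_iff {S : Finset (Fin g)} {a b : ℕ} (hb : b ≤ g)
    (h : ∀ p, p ∈ S ↔ a ≤ (p : ℕ) ∧ (p : ℕ) < b) : S.card = b - a := by
  rw [← Nat.card_Ico, ← Finset.card_map Fin.valEmbedding]
  congr 1
  ext x
  simp only [Finset.mem_map, h, Fin.valEmbedding_apply, Finset.mem_Ico]
  constructor
  · rintro ⟨p, hp, rfl⟩
    exact hp
  · intro hx
    exact ⟨⟨x, by omega⟩, hx, rfl⟩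

theorem mem_initialBlocks (ht : 0 < t) (hℓ : ℓ = t * w) {i : Fin t} {p : Fin g} :
    p ∈ initialBlocks g ℓ t i ↔ (i * w ≤ (p : ℕ) ∧ (p : ℕ) < i * w + w) ∨ ℓ ≤ (p : ℕ) := by
  rw [initialBlocks, Finset.mem_filter, hℓ, Nat.mul_div_cancel_left _ ht, add_mul, one_mul]
  simp

theorem mul_add_le_of_fin (hℓ : ℓ = t * w) (i : Fin t) : i * w + w ≤ ℓ := by
  have := Nat.mul_le_mul_right w (show (i : ℕ) + 1 ≤ t from i.2)
  rw [add_mul, one_mul] at this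
  omega

theorem card_filter_initialBlocks_lt (ht : 0 < t) (hℓ : ℓ = t * w) (hg : ℓ ≤ g) (i : Fin t) :
    ((initialBlocks g ℓ t i).filter fun p : Fin g => (p : ℕ) < ℓ).card = w := by
  have h := mul_add_le_of_fin hℓ i
  rw [card_eq_of_mem_iff (a := i * w) (b := i * w + w) (by omega)]
  · omega
  · intro p
    rw [Finset.mem_filter, mem_initialBlocks ht hℓ]
    omega

theorem card_filter_initialBlocks_ge (ht : 0 < t) (hℓ : ℓ = t * w) {h : ℕ} (hg : ℓ + h ≤ g)
    (i : Fin t) :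
    ((initialBlocks g ℓ t i).filter fun p : Fin g => ℓ ≤ (p : ℕ) ∧ (p : ℕ) < ℓ + h).card = h := by
  rw [card_eq_of_mem_iff (a := ℓ) (b := ℓ + h) hg]
  · omega
  · intro p
    rw [Finset.mem_filter, mem_initialBlocks ht hℓ]
    omega

theorem card_initialBlocks (ht : 0 < t) (hℓ : ℓ = t * w) (hg : ℓ ≤ g) (i : Fin t) :
    (initialBlocks g ℓ t i).card = w + (g - ℓ) := by
  rw [← Finset.card_filter_add_card_filter_not (s := initialBlocks g ℓ t i)
    (fun p : Fin g => (p : ℕ) < ℓ), card_filter_initialBlocks_lt ht hℓ hg i]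
  congr 1
  refine (card_eq_of_mem_iff (a := ℓ) (b := g) le_rfl fun p => ?_)
  rw [Finset.mem_filter, mem_initialBlocks ht hℓ]
  omega

theorem exists_mem_initialBlocks (ht : 0 < t) (hℓ : ℓ = t * w) {p : Fin g} (hp : (p : ℕ) < ℓ) :
    ∃ i : Fin t, p ∈ initialBlocks g ℓ t i := by
  have hw : 0 < w := Nat.pos_of_ne_zero fun h => by simp [hℓ, h] at hp
  refine ⟨⟨p / w, Nat.div_lt_of_lt_mul (by rwa [mul_comm, ← hℓ])⟩, ?_⟩
  rw [mem_initialBlocks ht hℓ]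
  have h1 := Nat.div_add_mod p w
  have h2 := Nat.mod_lt p hw
  rw [mul_comm] at h1
  left
  dsimp only
  omega

theorem le_of_mem_initialBlocks (ht : 0 < t) (hℓ : ℓ = t * w) {i j : Fin t} (hij : i ≠ j)
    {p : Fin g} (hi : p ∈ initialBlocks g ℓ t i) (hj : p ∈ initialBlocks g ℓ t j) :
    ℓ ≤ (p : ℕ) := by
  rw [mem_initialBlocks ht hℓ] at hi hj
  by_contra hlt
  apply hij
  have key (a b : ℕ) (h1 : a * w ≤ p) (h2 : p < b * w + w) : a ≤ b := by
    by_contra hab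
    have := Nat.mul_le_mul_right w (show b + 1 ≤ a by omega)
    rw [add_mul, one_mul] at this
    omega
  exact Fin.ext (le_antisymm (key _ _ (by omega) (by omega)) (key _ _ (by omega) (by omega)))

end InitialBlocks

/-! ### The conversion procedure. -/

theorem card_filter_comp_equiv_prod {α P : Type*} [Fintype α] {m : ℕ} {Q : Finset P}
    (e : α ≃ Fin m × {p // p ∈ Q}) (u : Fin m → Prop) (v : P → Prop) [DecidablePred u]
    [DecidablePred v] :
    (Finset.univ.filter fun a => u (e a).1 ∧ v (e a).2).card =
      (Finset.univ.filter u).card * (Q.filter v).card := by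
  rw [← Finset.card_product, ← Finset.card_map (e.toEmbedding.trans
    (blockEmbedding m (Function.Embedding.subtype (· ∈ Q))))]
  congr 1
  ext ⟨x, p⟩
  simp only [Finset.mem_map, Finset.mem_filter, Finset.mem_univ, true_and, Finset.mem_product]
  constructor
  · rintro ⟨a, ⟨h1, h2⟩, h⟩
    obtain ⟨rfl, rfl⟩ := Prod.ext_iff.mp h
    exact ⟨h1, (e a).2.2, h2⟩
  · rintro ⟨h1, hp, h2⟩
    refine ⟨e.symm (x, ⟨p, hp⟩), by simpa using ⟨h1, h2⟩, ?_⟩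
    rw [Function.Embedding.trans_apply, Equiv.coe_toEmbedding, Equiv.apply_symm_apply]
    rfl

theorem card_filter_fin_lt {m r : ℕ} (h : r ≤ m) :
    (Finset.univ.filter fun x : Fin m => (x : ℕ) < r).card = r := by
  rw [card_eq_of_mem_iff (a := 0) (b := r) h (by simp), Nat.sub_zero]

theorem map_funLeft_symm {F ι κ : Type*} [Field F] (e : κ ≃ ι) (C : Submodule F (ι → F)) :
    (C.map (LinearMap.funLeft F F e)).map (LinearMap.funLeft F F e.symm) = C := by
  rw [← Submodule.map_comp, ← LinearMap.funLeft_comp, e.self_comp_symm]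
  exact Submodule.map_id C

theorem mem_map_funLeft_equiv {F ι κ : Type*} [Field F] (e : κ ≃ ι) {C : Submodule F (ι → F)}
    {c : κ → F} : c ∈ C.map (LinearMap.funLeft F F e) ↔ c ∘ e.symm ∈ C := by
  constructor
  · rintro ⟨c, hc, rfl⟩
    have : LinearMap.funLeft F F e c ∘ e.symm = c := by
      ext i
      simp [LinearMap.funLeft_apply]
    rwa [this]
  · intro h
    exact ⟨_, h, by ext i; simp [LinearMap.funLeft_apply]⟩

/-- The codes shortened to the groups of initial blocks merge into the code punctured to the first
`ℓ + h` blocks: the leading blocks are kept, and from each of the `h` new blocks `r` symbols of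
every initial code are read. -/
theorem IsBlockLRC.exists_mergeConvertibleCode {F : Type*} [Field F] [DecidableEq F]
    {g ℓ r s t w h : ℕ} {D : Submodule F (Fin (r + s) × Fin g → F)} (hD : IsBlockLRC D ℓ)
    (hr : 0 < r) (hs : 0 < s) (ht : 0 < t) (hℓ : ℓ = t * w) (hg : ℓ + h ≤ g) {nI nF : ℕ}
    (eI : ∀ i, Fin nI ≃ Fin (r + s) × {p // p ∈ initialBlocks g ℓ t i})
    (eF : Fin nF ≃ Fin (r + s) × Fin (ℓ + h)) :
    ∃ X : MergeConvertibleCode F t nI nF,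
      (∀ i, X.initial i =
        (shortenedCode D (initialBlocks g ℓ t i)).map (LinearMap.funLeft F F (eI i))) ∧
      X.final = (D.map (LinearMap.funLeft F F
        (blockEmbedding (r + s) (Fin.castLEEmb hg)))).map (LinearMap.funLeft F F eF) ∧
      (∀ i, (X.unchanged i).card = (r + s) * w) ∧ ∀ i, (X.read i).card = r * h := by
  let φ : Fin nF → Fin (r + s) × Fin g := fun b => blockEmbedding (r + s) (Fin.castLEEmb hg) (eF b)
  let initial (i : Fin t) : Submodule F (Fin nI → F) :=
    (shortenedCode D (initialBlocks g ℓ t i)).map (LinearMap.funLeft F F (eI i))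
  let final : Submodule F (Fin nF → F) := (D.map (LinearMap.funLeft F F
    (blockEmbedding (r + s) (Fin.castLEEmb hg)))).map (LinearMap.funLeft F F eF)
  -- The trivial conjunct `True` gives the product form that `card_filter_comp_equiv_prod` counts.
  let unchanged (i : Fin t) : Finset (Fin nI) :=
    Finset.univ.filter fun a => True ∧ (((eI i a).2 : Fin g) : ℕ) < ℓ
  let read (i : Fin t) : Finset (Fin nI) := Finset.univ.filter fun a => ((eI i a).1 : ℕ) < r ∧
    (ℓ ≤ (((eI i a).2 : Fin g) : ℕ) ∧ (((eI i a).2 : Fin g) : ℕ) < ℓ + h)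
  let extend (i : Fin t) : (Fin nI → F) →ₗ[F] (Fin (r + s) × Fin g → F) :=
    extendBlocks F (r + s) (initialBlocks g ℓ t i) ∘ₗ LinearMap.funLeft F F (eI i).symm
  have h_ext i (x : Fin nI → F) : x ∈ initial i ↔ extend i x ∈ D := mem_map_funLeft_equiv (eI i)
  have h_ext_apply i (x : Fin nI → F) a : extend i x ((eI i a).1, (eI i a).2) = x a := by
    refine (extendBlocks_apply _ _ (eI i a).2.2).trans ?_
    simp [LinearMap.funLeft_apply]
  have h_final (c : Fin nF → F) : c ∈ final ↔ ∃ d ∈ D, ∀ b, d (φ b) = c b := by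
    constructor
    · rintro ⟨_, ⟨d, hd, rfl⟩, rfl⟩
      exact ⟨d, hd, fun b => rfl⟩
    · rintro ⟨d, hd, hdc⟩
      exact ⟨_, ⟨d, hd, rfl⟩, funext hdc⟩
  have h_mem_unchanged i (a : {a // a ∈ unchanged i}) : (((eI i a.1).2 : Fin g) : ℕ) < ℓ :=
    (Finset.mem_filter.mp a.2).2.2
  let placeFun (x : Σ i : Fin t, {a // a ∈ unchanged i}) : Fin nF :=
    eF.symm ((eI x.1 x.2.1).1, ⟨((eI x.1 x.2.1).2 : Fin g),
      (h_mem_unchanged x.1 x.2).trans_le (Nat.le_add_right ℓ h)⟩)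
  have hφ_place x : φ (placeFun x) = ((eI x.1 x.2.1).1, ((eI x.1 x.2.1).2 : Fin g)) := by
    simp only [φ, placeFun, Equiv.apply_symm_apply]
    rfl
  have h_place_inj : Function.Injective placeFun := by
    rintro ⟨i, a⟩ ⟨j, b⟩ hab
    have h1 := congrArg φ hab
    rw [hφ_place, hφ_place, Prod.mk.injEq] at h1
    obtain ⟨h1, h2⟩ := h1
    have hij : i = j := by
      by_contra hne
      have h3 := le_of_mem_initialBlocks ht hℓ hne (eI i a.1).2.2 (h2 ▸ (eI j b.1).2.2)
      have h4 := h_mem_unchanged i a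
      omega
    subst hij
    have h5 : a = b := Subtype.ext ((eI i).injective (Prod.ext h1 (Subtype.ext h2)))
    rw [h5]
  have h_range b (hb : b ∉ Set.range placeFun) : ℓ ≤ ((φ b).2 : ℕ) := by
    by_contra hlt
    obtain ⟨i, hi⟩ := exists_mem_initialBlocks ht hℓ (p := (φ b).2) (by omega)
    refine hb ⟨⟨i, (eI i).symm ((φ b).1, ⟨(φ b).2, hi⟩), ?_⟩, ?_⟩
    · refine Finset.mem_filter.mpr ⟨Finset.mem_univ _, trivial, ?_⟩
      rw [Equiv.apply_symm_apply]
      exact not_le.mp hlt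
    · simp only [placeFun, Equiv.apply_symm_apply]
      rw [Equiv.symm_apply_eq]
      rfl
  have h_sum_place (x : Fin t → Fin nI → F) i (a : {a // a ∈ unchanged i}) :
      (∑ j, extend j (x j)) (φ (placeFun ⟨i, a⟩)) = x i a := by
    rw [hφ_place, Finset.sum_apply, Finset.sum_eq_single i ?_ (by simp)]
    · exact h_ext_apply i (x i) a
    · intro j _ hji
      refine extendBlocks_apply_of_notMem _ _ fun hj => ?_
      have h3 := le_of_mem_initialBlocks ht hℓ hji hj (eI i a.1).2.2
      have h4 := h_mem_unchanged i a
      dsimp only at h3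
      omega
  -- Decoding: choose some initial codeword with the given read symbols. The default `0` is used
  -- only for symbols that come from no codeword.
  have h_pick i (y : {a // a ∈ read i} → F) : ∃ z : Fin nI → F,
      ∀ x ∈ initial i, (∀ a : {a // a ∈ read i}, x a = y a) →
        z ∈ initial i ∧ ∀ a : {a // a ∈ read i}, z a = y a := by
    by_cases hy : ∃ x ∈ initial i, ∀ a : {a // a ∈ read i}, x a = y a
    · obtain ⟨z, hz⟩ := hy
      exact ⟨z, fun _ _ _ => hz⟩
    · exact ⟨0, fun x hx hxy => absurd ⟨x, hx, hxy⟩ hy⟩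
  choose pick h_pick using h_pick
  -- The chosen codeword may differ from `x` elsewhere, but their difference vanishes on `r`
  -- coordinates of each new block, hence on the whole block.
  have h_determined i (x : Fin nI → F) (hx : x ∈ initial i) b (hb : b ∉ Set.range placeFun) :
      extend i (pick i fun a => x a) (φ b) = extend i x (φ b) := by
    obtain ⟨h1, h2⟩ := h_pick i (fun a => x a) x hx fun _ => rfl
    rw [h_ext] at hx h1
    rw [← sub_eq_zero]
    have hp : (φ b).2 ∈ initialBlocks g ℓ t i :=
      (mem_initialBlocks ht hℓ).mpr (Or.inr (h_range b hb))
    refine hD.eq_zero_of_prefix (D.sub_mem h1 hx) (p := (φ b).2) (fun y hy => ?_) (φ b).1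
    obtain ⟨a, ha⟩ := (eI i).surjective (y, ⟨(φ b).2, hp⟩)
    have ha' : (y, (φ b).2) = ((eI i a).1, ((eI i a).2 : Fin g)) := by rw [ha]
    have ha_read : a ∈ read i := by
      simp only [read, Finset.mem_filter, Finset.mem_univ, true_and, ha]
      exact ⟨hy, h_range b hb, (eF b).2.2⟩
    rw [Pi.sub_apply, ha', h_ext_apply, h_ext_apply, sub_eq_zero]
    exact h2 ⟨a, ha_read⟩
  have h_conv (x : Fin t → Fin nI → F) (hx : ∀ i, x i ∈ initial i) b
      (hb : b ∉ Set.range placeFun) :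
      (∑ j, extend j (x j)) (φ b) = ∑ j, extend j (pick j fun a => x j a) (φ b) := by
    rw [Finset.sum_apply]
    exact Finset.sum_congr rfl fun j _ => (h_determined j (x j) (hx j) b hb).symm
  have hQ i : (initialBlocks g ℓ t i)ᶜ.card + w = ℓ := by
    rw [Finset.card_compl, card_initialBlocks ht hℓ (by omega), Fintype.card_fin]
    have := mul_add_le_of_fin hℓ i
    omega
  have hT : (Finset.univ.filter fun p : Fin g => ℓ ≤ (p : ℕ)).card + ℓ ≤ Fintype.card (Fin g) := by
    rw [card_eq_of_mem_iff (a := ℓ) (b := g) le_rfl (by simp), Fintype.card_fin]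
    omega
  refine ⟨⟨initial, final, ?_, unchanged, read, ⟨placeFun, h_place_inj⟩,
    fun y b => ∑ j, extend j (pick j (y j)) (φ b), ?_⟩, fun i => rfl, rfl, fun i => ?_, fun i => ?_⟩
  · rw [finrank_map_funLeft_equiv, (hD.map_blocks (Fin.castLEEmb hg) (by simp)).dim_eq, hℓ]
    refine (Finset.sum_congr rfl fun i _ => (finrank_map_funLeft_equiv (eI i) _).trans
      (hD.shorten hr hs (hQ i)).dim_eq).trans ?_
    simp [mul_assoc]
  · ext c
    rw [SetLike.mem_coe, h_final, Set.mem_ofPred_eq]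
    constructor
    · rintro ⟨d, hd, hdc⟩
      obtain ⟨x, hx, rfl⟩ := hD.exists_sum_extendBlocks_eq hr hs hℓ.symm hQ hT
        (fun i j hij p hi hj => by simpa using le_of_mem_initialBlocks ht hℓ hij hi hj) hd
      have h1 i : extendBlocks F (r + s) (initialBlocks g ℓ t i) (x i) = extend i (x i ∘ eI i) := by
        simp only [extend, LinearMap.comp_apply]
        congr 1
        ext xp
        simp [LinearMap.funLeft_apply]
      simp only [h1] at hdc
      have h2 i : x i ∘ eI i ∈ initial i := Submodule.mem_map_of_mem (hx i)
      refine ⟨fun i => x i ∘ eI i, h2, fun i a => ?_, fun b => ?_⟩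
      · rw [← hdc]
        exact h_sum_place (fun i => x i ∘ eI i) i a
      · rw [← hdc]
        exact h_conv (fun i => x i ∘ eI i) h2 b.1 b.2
    · rintro ⟨x, hx, h1, h2⟩
      refine ⟨∑ j, extend j (x j), D.sum_mem fun j _ => (h_ext j (x j)).mp (hx j), fun b => ?_⟩
      by_cases hb : b ∈ Set.range placeFun
      · obtain ⟨⟨i, a⟩, rfl⟩ := hb
        exact (h_sum_place x i a).trans (h1 i a).symm
      · exact (h_conv x hx b hb).trans (h2 ⟨b, hb⟩).symm
  · refine (card_filter_comp_equiv_prod (eI i) (fun _ => True)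
      (fun p => (p : ℕ) < ℓ)).trans ?_
    rw [card_filter_initialBlocks_lt ht hℓ (by omega)]
    simp
  · refine (card_filter_comp_equiv_prod (eI i) (fun x => (x : ℕ) < r)
      (fun p => ℓ ≤ (p : ℕ) ∧ (p : ℕ) < ℓ + h)).trans ?_
    rw [card_filter_initialBlocks_ge ht hℓ hg, card_filter_fin_lt (by omega)]

/-! ### Evaluating the cost bounds at `d_F = h (r + s) + s + 1`. -/

theorem writeCostBound_eq {t w h r s : ℕ} (hr : 0 < r) (ht : 0 < t) :
    writeCostBound t (w * r) ((t * w + h) * (r + s)) r (s + 1) (h * (r + s) + (s + 1)) =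
      h * (r + s) := by
  obtain ⟨u, rfl⟩ : ∃ u, t = u + 1 := ⟨t - 1, by omega⟩
  rw [writeCostBound, Nat.add_sub_cancel, ← mul_assoc, localityDefect_mul _ _ _ hr]
  push_cast
  ring

theorem readCostDelta_eq {t w h r s : ℕ} (hr : 0 < r) (ht : 0 < t) :
    readCostDelta t (w * r) ((t * w + h) * (r + s)) r (s + 1) (h * (r + s) + (s + 1)) =
      ((w : ℤ) - h - 1) * (r + s) + r := by
  obtain ⟨u, rfl⟩ : ∃ u, t = u + 1 := ⟨t - 1, by omega⟩
  rw [readCostDelta, Nat.add_sub_cancel, ← mul_assoc, localityDefect_mul _ _ _ hr]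
  push_cast
  ring

theorem readCostBound_eq {t w h v r s : ℕ} (hr : 0 < r) (hs : 0 < s) (ht : 0 < t) (hhv : h ≤ v)
    (hvw : v < w) :
    readCostBound t (w * r) ((w + v) * (r + s)) ((t * w + h) * (r + s)) r (s + 1)
      (h * (r + s) + (s + 1)) = t * (r * h) := by
  -- Here `h ≤ v < w` gives `Δ ≥ r > 0`, and the gap in the distance condition is `(v - h)(r + s) +
  -- (w - 1) s ≥ 0`.
  have h1 : ¬ (((w : ℤ) - h - 1) * (r + s) + r ≤ 0 ∨
      (((w + v) * (r + s) : ℕ) : ℤ) - (w * r : ℕ) + 1 < (h * (r + s) + (s + 1) : ℕ)) := by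
    have h2 : (0 : ℤ) ≤ ((w : ℤ) - h - 1) * (r + s) := mul_nonneg (by omega) (by omega)
    have h3 : (0 : ℤ) ≤ ((v : ℤ) - h) * (r + s) := mul_nonneg (by omega) (by omega)
    have h4 : (0 : ℤ) ≤ ((w : ℤ) - 1) * s := mul_nonneg (by omega) (by omega)
    push_cast
    rintro (h | h) <;> nlinarith
  -- The division leaves remainder `r`, which is less than `r + s`.
  have h2 : ⌊(((((w : ℤ) - h - 1) * (r + s) + r : ℤ)) : ℚ) / ((r : ℚ) + (s + 1 : ℕ) - 1)⌋ =
      (w : ℤ) - h - 1 := by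
    have hr' : (0 : ℚ) < r := by exact_mod_cast hr
    have hs' : (0 : ℚ) < s := by exact_mod_cast hs
    rw [Int.floor_eq_iff]
    push_cast
    rw [show (r : ℚ) + (s + 1) - 1 = r + s by ring, le_div_iff₀ (by positivity),
      div_lt_iff₀ (by positivity)]
    constructor <;> nlinarith
  rw [readCostBound, readCostDelta_eq hr ht, if_neg h1, h2]
  push_cast
  ring

/-! ### Assembling the theorem, with `ℓ = t * w` and `δ = s + 1`. -/

theorem exists_accessOptimal_conversion {F : Type*} [Field F] [DecidableEq F]
    {g t w r s d : ℕ} (hw : 0 < w) (hr : 0 < r) (hs : 0 < s) (ht : 0 < t)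
    (hg : t * w ≤ g) (hv : g - t * w < w) {C : Submodule F (Fin (g * (r + s)) → F)}
    (hC : IsOptimalLRC C (t * w * r) d r (s + 1)) :
    ∃ (A : Fin g → Matrix (Fin s) (Fin (r + s)) F)
      (B : Fin g → Matrix (Fin ((g - t * w) * r)) (Fin (r + s)) F)
      (e : Fin (g * (r + s)) ≃ Fin (r + s) × Fin g),
      IsRearrangement e C (codeOfParityCheck (blockParityCheck A B)) ∧
      ∀ h : ℕ, h ≤ g - t * w →
        ∃ X : MergeConvertibleCode F t ((w + (g - t * w)) * (r + s)) ((t * w + h) * (r + s)),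
          X.IsLRCC (w * r) r (s + 1) (t * w * r) r (s + 1) ∧
          X.IsAccessOptimal (w * r) r (s + 1) ∧
          (∀ i, ∃ dI, IsOptimalLRC (X.initial i) (w * r) dI r (s + 1)) ∧
          (∃ dF, IsOptimalLRC X.final (t * w * r) dF r (s + 1)) ∧
          (∀ i, ∃ eI : Fin ((w + (g - t * w)) * (r + s)) ≃
              Fin (r + s) × {p // p ∈ initialBlocks g (t * w) t i},
            IsRearrangement eI (X.initial i)
              (codeOfParityCheck (subBlockParityCheck A B (initialBlocks g (t * w) t i)))) ∧
          (∃ eF : Fin ((t * w + h) * (r + s)) ≃ {x // x ∈ leadingCoords e (t * w + h)},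
            IsRearrangement eF X.final (puncturedCode C (leadingCoords e (t * w + h)))) := by
  have hℓ : 0 < t * w := Nat.mul_pos ht hw
  -- If `t * w = 1` then `w = 1`, and `g - t * w < w` leaves a single block.
  have hg1 : t * w = 1 → g = 1 := fun h1 => by
    have := Nat.le_mul_of_pos_left w ht
    omega
  obtain ⟨e, he⟩ := (hC.isTightLRC hr).exists_blocks hr hs hℓ hg1 (Fintype.card_fin _)
  have hD := (hC.isTightLRC hr).isBlockLRC e he
  obtain ⟨A, B, hAB⟩ : ∃ (A : Fin g → Matrix (Fin s) (Fin (r + s)) F)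
      (B : Fin g → Matrix (Fin ((g - t * w) * r)) (Fin (r + s)) F),
      codeOfParityCheck (blockParityCheck A B) = C.map (LinearMap.funLeft F F e.symm) := by
    have := hD.exists_parityCheck hr hs hℓ (by rwa [Fintype.card_fin])
    rwa [Fintype.card_fin] at this
  refine ⟨A, B, e, hAB.symm, fun h hh => ?_⟩
  set D := C.map (LinearMap.funLeft F F e.symm) with hD_def
  have hgh : t * w + h ≤ g := by omega
  have hQ i := card_initialBlocks (g := g) ht rfl hg i
  have eI i : Fin ((w + (g - t * w)) * (r + s)) ≃
      Fin (r + s) × {p // p ∈ initialBlocks g (t * w) t i} :=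
    Fintype.equivOfCardEq (by
      rw [Fintype.card_fin, Fintype.card_prod, Fintype.card_coe, hQ, Fintype.card_fin, mul_comm])
  let eF : Fin ((t * w + h) * (r + s)) ≃ Fin (r + s) × Fin (t * w + h) :=
    finProdFinEquiv.symm.trans (Equiv.prodComm _ _)
  obtain ⟨X, hXI, hXF, hXu, hXr⟩ := hD.exists_mergeConvertibleCode hr hs ht rfl hgh eI eF
  have hQc i : (initialBlocks g (t * w) t i)ᶜ.card + w = t * w := by
    rw [Finset.card_compl, hQ, Fintype.card_fin]
    have := Nat.le_mul_of_pos_left w ht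
    omega
  have hI i := (hD.shorten hr hs (hQc i)).isOptimalLRC_map hr hs hw
    (Nat.le_add_right w (g - t * w)) (by rw [Fintype.card_coe, hQ]) (eI i)
  have hF := (hD.map_blocks (Fin.castLEEmb hgh) (by simp)).isOptimalLRC_map hr hs hℓ
    (Nat.le_add_right _ h) (Fintype.card_fin _) eF
  simp only [← hXI] at hI
  rw [← hXF, Nat.add_sub_cancel_left] at hF
  refine ⟨X, ⟨fun i => (hI i).dim_eq, fun i => (hI i).locality, hF.dim_eq, hF.locality⟩,
    ⟨_, hF.minDist, ?_, ?_⟩, fun i => ⟨_, hI i⟩, ⟨_, hF⟩, fun i => ⟨eI i, ?_⟩, ?_⟩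
  · rw [readCostBound_eq hr hs ht hh hv, MergeConvertibleCode.readCost]
    simp [hXr]
  · rw [writeCostBound_eq hr ht, MergeConvertibleCode.writeCost]
    simp only [hXu, Finset.sum_const, Finset.card_univ, Fintype.card_fin, nsmul_eq_mul]
    push_cast
    ring
  · rw [IsRearrangement, hXI, map_funLeft_symm, ← hAB, shortenedCode_codeOfParityCheck]
    rfl
  -- The final code is built by restricting the rearranged code to the first blocks; `ψ` identifies
  -- its coordinates with those kept in the original order of `C`.
  · let ψ (b : Fin ((t * w + h) * (r + s))) : {x // x ∈ leadingCoords e (t * w + h)} :=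
      ⟨e.symm (blockEmbedding (r + s) (Fin.castLEEmb hgh) (eF b)), by
        rw [leadingCoords, Finset.mem_filter, Equiv.apply_symm_apply]
        exact ⟨Finset.mem_univ _, (eF b).2.2⟩⟩
    have hψ : Function.Bijective ψ := by
      constructor
      · intro b b' hb
        exact eF.injective ((blockEmbedding _ _).injective
          (e.symm.injective (congrArg Subtype.val hb)))
      · rintro ⟨x, hx⟩
        have hx' : ((e x).2 : ℕ) < t * w + h := (Finset.mem_filter.mp hx).2
        refine ⟨eF.symm ((e x).1, ⟨(e x).2, hx'⟩), Subtype.ext ?_⟩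
        simp only [ψ, Equiv.apply_symm_apply]
        exact e.symm_apply_apply x
    refine ⟨Equiv.ofBijective ψ hψ, ?_⟩
    have h1 : X.final = (puncturedCode C (leadingCoords e (t * w + h))).map
        (LinearMap.funLeft F F (Equiv.ofBijective ψ hψ)) := by
      rw [hXF, hD_def, puncturedCode, ← Submodule.map_comp, ← Submodule.map_comp,
        ← Submodule.map_comp]
      rfl
    rw [IsRearrangement, h1, map_funLeft_symm]

theorem theorem3 {F : Type*} [Field F] [Finite F] [DecidableEq F]
    (g ℓ r δ t d : ℕ) (hg : 0 < g) (hℓ : 0 < ℓ) (hr : 0 < r) (ht : 0 < t) (hδ : 2 ≤ δ)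
    (htℓ : t ∣ ℓ) (hℓg : ℓ ≤ g) (hs : g - ℓ < ℓ / t)
    (C : Submodule F (Fin (g * (r + δ - 1)) → F))
    (hC : IsOptimalLRC C (ℓ * r) d r δ) :
    ∃ (A : Fin g → Matrix (Fin (δ - 1)) (Fin (r + δ - 1)) F)
      (B : Fin g → Matrix (Fin ((g - ℓ) * r)) (Fin (r + δ - 1)) F)
      (e : Fin (g * (r + δ - 1)) ≃ Fin (r + δ - 1) × Fin g),
      IsRearrangement e C (codeOfParityCheck (blockParityCheck A B)) ∧
      ∀ h : ℕ, h ≤ g - ℓ →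
        ∃ X : MergeConvertibleCode F t ((ℓ / t + (g - ℓ)) * (r + δ - 1)) ((ℓ + h) * (r + δ - 1)),
          X.IsLRCC (ℓ * r / t) r δ (ℓ * r) r δ ∧
          X.IsAccessOptimal (ℓ * r / t) r δ ∧
          (∀ i, ∃ dI, IsOptimalLRC (X.initial i) (ℓ * r / t) dI r δ) ∧
          (∃ dF, IsOptimalLRC X.final (ℓ * r) dF r δ) ∧
          (∀ i, ∃ eI : Fin ((ℓ / t + (g - ℓ)) * (r + δ - 1)) ≃
              Fin (r + δ - 1) × {p // p ∈ initialBlocks g ℓ t i},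
            IsRearrangement eI (X.initial i)
              (codeOfParityCheck (subBlockParityCheck A B (initialBlocks g ℓ t i)))) ∧
          (∃ eF : Fin ((ℓ + h) * (r + δ - 1)) ≃ {x // x ∈ leadingCoords e (ℓ + h)},
            IsRearrangement eF X.final (puncturedCode C (leadingCoords e (ℓ + h)))) := by
  obtain ⟨w, rfl⟩ := htℓ
  obtain ⟨s, rfl⟩ : ∃ s, δ = s + 1 := ⟨δ - 1, by omega⟩
  rw [Nat.mul_div_cancel_left w ht] at hs
  rw [Nat.mul_div_cancel_left w ht, mul_assoc t w r, Nat.mul_div_cancel_left (w * r) ht,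
    ← mul_assoc t w r]
  -- Here `r + (s + 1) - 1` and `s + 1 - 1` agree definitionally with `r + s` and `s`.
  exact exists_accessOptimal_conversion (Nat.pos_of_mul_pos_left hℓ) hr (by omega) ht hℓg hs hC
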